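/- Let $n,k,L\ge 1$ be integers. Consider $n$ items with latent scores $\theta^\star_1\ge\theta^\star_2\ge\dots\ge\theta^\star_n$, normalized by $\sum_{i}\theta^\star_i=0$, and put $\kappa:=e^{\theta^\star_1}/e^{\theta^\star_n}$ and, for $1\le K<n$, $\Delta_K:=\theta^\star_K-\theta^\star_{K+1}$. Let $\varphi:[n]\to[k]$ be a cluster labeling, $n_t:=|\{i:\varphi(i)=t\}|$, and let $0\le q<p_t\le 1$ for all $t\in[k]$. A random comparison graph on $[n]$ with edge set $\mathcal E$ contains each pair $\{i,j\}$, $i\ne j$, independently, with probability $p_t$ if $\varphi(i)=\varphi(j)=t$ and with probability $q$ if $\varphi(i)\neq\varphi(j)$. For every edge with $i>j$ one observes $L$ Bernoulli variables $y_{ij}^{(1)},\dots,y_{ij}^{(L)}$ with $$\mathbb P\bigl(y_{ij}^{(l)}=1\bigr)=\frac{e^{\theta^\star_j}}{e^{\theta^\star_i}+e^{\theta^\star_j}}$$ (so $y_{ij}^{(l)}=1$ means that $j$ beats $i$), all independent of each other and of the graph. The vanilla (unweighted) MLE is $$\widehat\theta:=\arg\min_{\theta\in\mathbb R^n:\ \sum_i\theta_i=0}\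 -\frac1L\sum_{(i,j)\in\mathcal E,\ i>j}\ \sum_{l=1}^L\log\left(y_{ij}^{(l)}\frac{e^{\theta_j}}{e^{\theta_i}+e^{\theta_j}}+\bigl(1-y_{ij}^{(l)}\bigr)\frac{e^{\theta_i}}{e^{\theta_i}+e^{\theta_j}}\right).$$ There are absolute constants $C_1,C_2,C_3,C_4,C_5>0$ such that the following holds for all such data. Suppose that $$nq\ge C_1\log n,\qquad nqL\ge C_2\kappa^4\log^3 n,$$ and that, for every $t\in[k]$, $$n_tp_t\ge C_1\log n,\qquad n^2q^2L\ge C_2\kappa^4\,n_tp_t\log^3 n.$$ Then, with probability at least $1-C_5n^{-10}$, the MLE $\widehat\theta$ exists, is unique, and satisfies $$\|\widehat\theta-\theta^\star\|_\infty\le C_3\,\kappa\sqrt{\frac{\log n}{nqL}},$$ and, on the same event, for every $1\le K<n$ with $\Delta_K>0$ and $$n^2qL\ge C_4\,\frac{\kappa^2\,n\log n}{\Delta_K^2},$$ the top-$K$ items are recovered exactly, i.e. the $K$ largest entries of $\widehat\theta$ are uniquely determined and are those with indices $1,\dots,K$. -/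

import Mathlib

open MeasureTheory ProbabilityTheory

noncomputable section

namespace ClusterRanking

/-- Unordered pairs of distinct items, stored as `(i, j)` with `i > j`. -/
abbrev Pair (n : ℕ) : Type := {e : Fin n × Fin n // e.2 < e.1}

/-- The number of items with label `t`. -/
def clusterSize {n k : ℕ} (φ : Fin n → Fin k) (t : Fin k) : ℕ :=
  (Finset.univ.filter fun i => φ i = t).card

/-- The sampling probability of a pair: `p t` inside cluster `t`, and `q` across clusters. -/
def edgeProb {n k : ℕ} (φ : Fin n → Fin k) (p : Fin k → ℝ) (q : ℝ) (e : Pair n) : ℝ :=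
  if φ e.1.1 = φ e.1.2 then p (φ e.1.1) else q

/-- The Bradley-Terry-Luce probability that item `a` beats item `b`. -/
def winProb {n : ℕ} (θ : Fin n → ℝ) (a b : Fin n) : ℝ :=
  Real.exp (θ a) / (Real.exp (θ a) + Real.exp (θ b))

/-- Clustered sampling of a comparison graph, with `L` Bradley-Terry-Luce comparisons per edge.
`edge e` says whether the pair `e` is compared. For `e = (i, j)` with `i > j`, `outcome e l` is the
`l`-th result `y_ij^(l)`; it is `true` when `j` beats `i`. Results are defined for all pairs, but
only those on the edges of the graph enter the likelihood. -/
structure IsClusteredBTL {Ω : Type*} [MeasurableSpace Ω] (μ : Measure Ω) {n k L : ℕ}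
    (φ : Fin n → Fin k) (p : Fin k → ℝ) (q : ℝ) (θ : Fin n → ℝ)
    (edge : Pair n → Ω → Bool) (outcome : Pair n → Fin L → Ω → Bool) : Prop where
  measurable_edge : ∀ e, Measurable (edge e)
  measurable_outcome : ∀ e l, Measurable (outcome e l)
  prob_edge : ∀ e, μ.real {ω | edge e ω = true} = edgeProb φ p q e
  prob_outcome : ∀ e l, μ.real {ω | outcome e l ω = true} = winProb θ e.1.2 e.1.1
  /-- All edge indicators and all comparison results are mutually independent. -/
  indep : iIndepFun
    (Sum.elim edge (fun s : Pair n × Fin L => outcome s.1 s.2) :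
      Pair n ⊕ (Pair n × Fin L) → Ω → Bool) μ

/-- The weighted negative log-likelihood
`-(1/L) ∑_{i > j} ∑_l w_ij log (probability under θ of the observed result)`. -/
def weightedLoss {n L : ℕ} (w : Pair n → ℝ) (y : Pair n → Fin L → Bool) (θ : Fin n → ℝ) : ℝ :=
  -(1 / (L : ℝ)) * ∑ e : Pair n, ∑ l : Fin L,
    w e * Real.log (if y e l then winProb θ e.1.2 e.1.1 else winProb θ e.1.1 e.1.2)

/-- `x` is a weighted maximum likelihood estimate: it minimizes the loss over the vectors whose
entries sum to zero. -/
def IsWeightedMLE {n L : ℕ} (w : Pair n → ℝ) (y : Pair n → Fin L → Bool) (x : Fin n → ℝ) : Prop :=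
  ∑ i, x i = 0 ∧
    ∀ x' : Fin n → ℝ, ∑ i, x' i = 0 → weightedLoss w y x ≤ weightedLoss w y x'

/-- The vanilla (unweighted) MLE on a comparison graph: weight `1` on its edges, `0` elsewhere. -/
def IsMLE {n L : ℕ} (g : Pair n → Bool) (y : Pair n → Fin L → Bool) (x : Fin n → ℝ) : Prop :=
  IsWeightedMLE (fun e => if g e then 1 else 0) y x

/-- The condition number `κ = exp θ_1 / exp θ_n` of a non-increasing score vector. -/
def kappa {n : ℕ} (hn : 0 < n) (θ : Fin n → ℝ) : ℝ :=
  Real.exp (θ ⟨0, hn⟩) / Real.exp (θ ⟨n - 1, Nat.sub_lt hn Nat.one_pos⟩)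

/-- The gap `Δ_K = θ_K - θ_{K+1}` (items counted from one), for `1 ≤ K < n`. -/
def scoreGap {n : ℕ} (θ : Fin n → ℝ) (K : ℕ) (hKn : K < n) : ℝ :=
  θ ⟨K - 1, lt_of_le_of_lt (Nat.sub_le K 1) hKn⟩ - θ ⟨K, hKn⟩

/-- `S` is a possible selection of the `K` largest entries of `x`. -/
def IsTopK {n : ℕ} (x : Fin n → ℝ) (K : ℕ) (S : Finset (Fin n)) : Prop :=
  S.card = K ∧ ∀ i ∈ S, ∀ j ∉ S, x j ≤ x i

/-- Exact recovery: the first `K` items are the one and only selection of the `K` largest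
entries of `x`. -/
def RecoversTopK {n : ℕ} (x : Fin n → ℝ) (K : ℕ) : Prop :=
  ∀ S : Finset (Fin n), IsTopK x K S ↔ S = Finset.univ.filter fun i : Fin n => (i : ℕ) < K

end ClusterRanking

end

/-! The estimate is localized in sup norm by testing one Newton step against approximate Green's
functions of the comparison graph.

Weight every edge by the curvature of the loss at `θ` and let `lap` be the resulting Laplacian. For
each item `i`, `exists_potential` gives `u` with `lap u = 1_i - 1/n - r` and `‖r‖₁ ≤ 1/2`: the time
spent at each vertex by a lazy random walk from `i`, run until it mixes. Its energy is `O(1/Λ)`,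
where `Λ` is the spectral gap. An entropy argument bounds its weighted total variation by `O(log n
√(D/Λ))`, where `D` bounds the degrees. Large clusters with many comparisons enter only through `D`.

Take `x` in the sup-norm box of radius `ε` around `θ`, and let `z` be the Newton step at `x` with
the Hessian frozen at `θ`. Pairing `x + z - θ` with the potential of its largest coordinate leaves
three terms: at most half of that coordinate (from `r`), a Taylor remainder of order `ε²` times the
total variation, and the noise at `θ` paired with `u`. Hence `x + z` lies in the box of radius `ε/2`
(`newton_step_bound`). If `x` minimizes the loss over the box, the direction `z` is feasible, which
forces `z = 0`. The gradient on zero-sum vectors then vanishes, and convexity makes `x` the unique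
MLE (`exists_weightedMLE_near`).

Three random events are needed. Every vertex set of at most half the items expands at rate of order
`nq`, which a multi-scale Cheeger inequality turns into a gap of the same order
(`spectral_gap_of_expansion`). The degrees are bounded by Chernoff. The noise against `u` is small
by Hoeffding conditionally on the graph, since `u` depends on the graph alone and the energy of `u`
controls the variance. Top-`K` recovery follows because the sup-norm error is below half the gap
`Δ_K`. -/

noncomputable section

namespace ClusterRanking

/-! ### Weighted graph Laplacians: energy, lazy walk, entropy bound on total variation. -/

section Laplacian

variable {V : Type*} [Fintype V]

/-- The Laplacian of a weighted graph. -/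
def lap (W : V → V → ℝ) (x : V → ℝ) (i : V) : ℝ := ∑ j, W i j * (x i - x j)

lemma sum_mul_lap {W : V → V → ℝ} (hW : ∀ i j, W i j = W j i) (y x : V → ℝ) :
    ∑ i, y i * lap W x i = 1 / 2 * ∑ i, ∑ j, W i j * ((y i - y j) * (x i - x j)) := by
  have h1 : ∑ i, y i * lap W x i = ∑ i, ∑ j, W i j * (y i * (x i - x j)) := by
    refine Finset.sum_congr rfl fun i _ => ?_
    rw [lap, Finset.mul_sum]
    exact Finset.sum_congr rfl fun j _ => by ring
  have h2 : ∑ i, y i * lap W x i = ∑ i, ∑ j, W i j * (-y j * (x i - x j)) := by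
    rw [h1, Finset.sum_comm]
    refine Finset.sum_congr rfl fun i _ => Finset.sum_congr rfl fun j _ => ?_
    rw [hW]; ring
  have h3 : ∑ i, ∑ j, W i j * ((y i - y j) * (x i - x j)) =
      ∑ i, ∑ j, W i j * (y i * (x i - x j)) + ∑ i, ∑ j, W i j * (-y j * (x i - x j)) := by
    rw [← Finset.sum_add_distrib]
    refine Finset.sum_congr rfl fun i _ => ?_
    rw [← Finset.sum_add_distrib]
    exact Finset.sum_congr rfl fun j _ => by ring
  rw [h3, ← h1, ← h2]; ring

lemma sum_mul_lap_comm {W : V → V → ℝ} (hW : ∀ i j, W i j = W j i) (y x : V → ℝ) :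
    ∑ i, y i * lap W x i = ∑ i, x i * lap W y i := by
  rw [sum_mul_lap hW, sum_mul_lap hW]
  congr 1
  exact Finset.sum_congr rfl fun i _ => Finset.sum_congr rfl fun j _ => by ring

lemma sum_lap {W : V → V → ℝ} (hW : ∀ i j, W i j = W j i) (x : V → ℝ) :
    ∑ i, lap W x i = 0 := by
  have := sum_mul_lap hW (fun _ => 1) x
  simpa using this

lemma lap_add (W : V → V → ℝ) (x y : V → ℝ) (i : V) :
    lap W (fun j => x j + y j) i = lap W x i + lap W y i := by
  simp only [lap, ← Finset.sum_add_distrib]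
  exact Finset.sum_congr rfl fun j _ => by ring

lemma lap_smul (W : V → V → ℝ) (c : ℝ) (x : V → ℝ) (i : V) :
    lap W (fun j => c * x j) i = c * lap W x i := by
  simp only [lap, Finset.mul_sum]
  exact Finset.sum_congr rfl fun j _ => by ring

lemma lap_sub_const (W : V → V → ℝ) (c : ℝ) (x : V → ℝ) (i : V) :
    lap W (fun j => x j - c) i = lap W x i := by
  simp only [lap]
  exact Finset.sum_congr rfl fun j _ => by ring

lemma lap_sum (W : V → V → ℝ) {ι : Type*} (s : Finset ι) (f : ι → V → ℝ) (i : V) :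
    lap W (fun j => ∑ t ∈ s, f t j) i = ∑ t ∈ s, lap W (f t) i := by
  simp only [lap]
  rw [Finset.sum_comm]
  refine Finset.sum_congr rfl fun j _ => ?_
  rw [← Finset.sum_sub_distrib, Finset.mul_sum]

lemma energy_nonneg {W : V → V → ℝ} (hW : ∀ i j, W i j = W j i) (hW0 : ∀ i j, 0 ≤ W i j)
    (x : V → ℝ) : 0 ≤ ∑ i, x i * lap W x i := by
  rw [sum_mul_lap hW]
  have : 0 ≤ ∑ i, ∑ j, W i j * ((x i - x j) * (x i - x j)) :=
    Finset.sum_nonneg fun i _ => Finset.sum_nonneg fun j _ =>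
      mul_nonneg (hW0 i j) (mul_self_nonneg _)
  linarith

/-- Cauchy–Schwarz in each row with weights `W i j`. This is the operator bound `lap ≤ 2D` in
quadratic form, and it is why the walk uses the step `1/(2D)`. -/
lemma sum_sq_lap_le {W : V → V → ℝ} (hW : ∀ i j, W i j = W j i) (hW0 : ∀ i j, 0 ≤ W i j)
    {D : ℝ} (hD : ∀ i, ∑ j, W i j ≤ D) (x : V → ℝ) :
    ∑ i, lap W x i ^ 2 ≤ 2 * D * ∑ i, x i * lap W x i := by
  rw [sum_mul_lap hW]
  have : ∀ i, lap W x i ^ 2 ≤ D * ∑ j, W i j * ((x i - x j) * (x i - x j)) := by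
    intro i
    have h := Finset.sum_sq_le_sum_mul_sum_of_sq_le_mul Finset.univ
      (r := fun j => W i j * (x i - x j)) (f := fun j => W i j)
      (g := fun j => W i j * ((x i - x j) * (x i - x j))) (fun j _ => hW0 i j)
      (fun j _ => mul_nonneg (hW0 i j) (mul_self_nonneg _)) (fun j _ => le_of_eq (by ring))
    refine h.trans (mul_le_mul_of_nonneg_right (hD i) ?_)
    exact Finset.sum_nonneg fun j _ => mul_nonneg (hW0 i j) (mul_self_nonneg _)
  calc ∑ i, lap W x i ^ 2 ≤ ∑ i, D * ∑ j, W i j * ((x i - x j) * (x i - x j)) :=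
        Finset.sum_le_sum fun i _ => this i
    _ = _ := by rw [← Finset.mul_sum]; ring

/-- One step of the lazy random walk with jump rate `W / (2 D)`. -/
def walk (W : V → V → ℝ) (D : ℝ) (x : V → ℝ) (i : V) : ℝ := x i - lap W x i / (2 * D)

lemma sum_walk {W : V → V → ℝ} (hW : ∀ i j, W i j = W j i) (D : ℝ) (x : V → ℝ) :
    ∑ i, walk W D x i = ∑ i, x i := by
  simp only [walk, Finset.sum_sub_distrib, ← Finset.sum_div, sum_lap hW]; simp

lemma walk_sub_const (W : V → V → ℝ) (D c : ℝ) (x : V → ℝ) :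
    walk W D (fun j => x j - c) = fun j => walk W D x j - c := by
  funext i; simp only [walk, lap_sub_const]; ring

lemma walk_nonneg {W : V → V → ℝ} (hW0 : ∀ i j, 0 ≤ W i j) {D : ℝ} (hD0 : 0 < D)
    (hD : ∀ i, ∑ j, W i j ≤ D) {x : V → ℝ} (hx : ∀ i, 0 ≤ x i) (i : V) :
    0 ≤ walk W D x i := by
  have h1 : lap W x i ≤ D * x i := by
    calc lap W x i ≤ ∑ j, W i j * x i :=
          Finset.sum_le_sum fun j _ => mul_le_mul_of_nonneg_left (by linarith [hx j]) (hW0 i j)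
      _ = (∑ j, W i j) * x i := by rw [Finset.sum_mul]
      _ ≤ D * x i := mul_le_mul_of_nonneg_right (hD i) (hx i)
  have h2 : lap W x i / (2 * D) ≤ x i := by
    rw [div_le_iff₀ (by positivity)]
    nlinarith [mul_nonneg hD0.le (hx i)]
  simp only [walk]; linarith

/-- Expanding the square gives `‖x‖² - E/D + ‖lap x‖²/(4D²)` with `E` the energy. The last term
returns at most half of the gain `E/D`, so a factor `1 - Λ/(2D)` remains. -/
lemma sum_sq_walk_le {W : V → V → ℝ} (hW : ∀ i j, W i j = W j i) (hW0 : ∀ i j, 0 ≤ W i j)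
    {D Λ : ℝ} (hD0 : 0 < D) (hD : ∀ i, ∑ j, W i j ≤ D)
    (hgap : ∀ x : V → ℝ, ∑ i, x i = 0 → Λ * ∑ i, x i ^ 2 ≤ ∑ i, x i * lap W x i)
    {x : V → ℝ} (hx : ∑ i, x i = 0) :
    ∑ i, walk W D x i ^ 2 ≤ Real.exp (-(Λ / (2 * D))) * ∑ i, x i ^ 2 := by
  have h1 : ∑ i, walk W D x i ^ 2 = ∑ i, x i ^ 2 - (∑ i, x i * lap W x i) / D +
      (∑ i, lap W x i ^ 2) / (4 * D ^ 2) := by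
    rw [Finset.sum_div, Finset.sum_div, ← Finset.sum_sub_distrib, ← Finset.sum_add_distrib]
    refine Finset.sum_congr rfl fun i _ => ?_
    simp only [walk]; field_simp; ring
  have h2 : (∑ i, lap W x i ^ 2) / (4 * D ^ 2) ≤ (∑ i, x i * lap W x i) / (2 * D) := by
    rw [div_le_div_iff₀ (by positivity) (by positivity)]
    have := mul_le_mul_of_nonneg_left (sum_sq_lap_le hW hW0 hD x) (by positivity : 0 ≤ 2 * D)
    linarith
  have h3 : (∑ i, x i * lap W x i) / D = 2 * ((∑ i, x i * lap W x i) / (2 * D)) := by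
    field_simp
  have h4 : Λ / (2 * D) * ∑ i, x i ^ 2 ≤ (∑ i, x i * lap W x i) / (2 * D) := by
    rw [div_mul_eq_mul_div]
    exact div_le_div_of_nonneg_right (hgap x hx) (by positivity)
  have h5 : 1 - Λ / (2 * D) ≤ Real.exp (-(Λ / (2 * D))) := by
    have := Real.add_one_le_exp (-(Λ / (2 * D))); linarith
  have h6 := mul_le_mul_of_nonneg_right h5
    (Finset.sum_nonneg fun i _ => sq_nonneg (x i) : 0 ≤ ∑ i, x i ^ 2)
  linarith

/-- The test vector `1_a - 1_b` suffices. The bound is needed to absorb the rounding of the number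
of walk steps. -/
lemma gap_le_two_mul_degree [DecidableEq V] {W : V → V → ℝ} (hW : ∀ i j, W i j = W j i)
    (hW0 : ∀ i j, 0 ≤ W i j) {D Λ : ℝ} (hD0 : 0 < D) (hD : ∀ i, ∑ j, W i j ≤ D)
    (hcard : 2 ≤ Fintype.card V)
    (hgap : ∀ x : V → ℝ, ∑ i, x i = 0 → Λ * ∑ i, x i ^ 2 ≤ ∑ i, x i * lap W x i) :
    Λ ≤ 2 * D := by
  obtain ⟨a, b, hab⟩ := Fintype.one_lt_card_iff.mp hcard
  let x : V → ℝ := fun j => (if j = a then 1 else 0) - (if j = b then 1 else 0)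
  have hx0 : ∑ i, x i = 0 := by simp [x, Finset.sum_sub_distrib]
  have hpos : 0 < ∑ i, x i ^ 2 := by
    refine Finset.sum_pos' (fun i _ => sq_nonneg _) ⟨a, Finset.mem_univ _, ?_⟩
    simp [x, hab]
  set S := ∑ i, x i ^ 2
  set E := ∑ i, x i * lap W x i with hE
  have h1 := hgap x hx0
  have h2 : E ^ 2 ≤ S * (2 * D * E) :=
    (Finset.sum_mul_sq_le_sq_mul_sq Finset.univ x (lap W x)).trans
      (mul_le_mul_of_nonneg_left (sum_sq_lap_le hW hW0 hD x) hpos.le)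
  have hE0 : 0 ≤ E := energy_nonneg hW hW0 x
  have h3 : E ≤ 2 * D * S := by
    rcases hE0.eq_or_lt with h | h
    · rw [← h]; positivity
    · nlinarith
  nlinarith

/-- The pointwise form of the entropy dissipation inequality. -/
lemma sq_sub_le_mul_log_sub {a b : ℝ} (ha : 0 < a) (hb : 0 < b) :
    (a - b) ^ 2 ≤ (a - b) * (Real.log a - Real.log b) * (a + b) := by
  wlog h : b ≤ a generalizing a b
  · have := this hb ha (by linarith)
    nlinarith
  have h1 : 1 - b / a ≤ Real.log a - Real.log b := by
    have := Real.one_sub_inv_le_log_of_pos (div_pos ha hb)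
    rwa [inv_div, Real.log_div ha.ne' hb.ne'] at this
  have h2 : a - b ≤ (Real.log a - Real.log b) * a := by
    have := mul_le_mul_of_nonneg_right h1 ha.le
    rwa [sub_mul, one_mul, div_mul_cancel₀ _ ha.ne'] at this
  have h3 : 0 ≤ Real.log a - Real.log b := sub_nonneg.mpr (Real.log_le_log hb h)
  nlinarith [mul_nonneg (sub_nonneg.mpr h) (mul_nonneg h3 hb.le),
    mul_le_mul_of_nonneg_left h2 (sub_nonneg.mpr h)]

/-- Total variation of a nonnegative potential whose Laplacian is `1_i - π` with `π` a probability
vector. -/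
lemma sq_total_variation_le [DecidableEq V] {W : V → V → ℝ} (hW : ∀ i j, W i j = W j i)
    (hW0 : ∀ i j, 0 ≤ W i j) {D : ℝ} (hD : ∀ i, ∑ j, W i j ≤ D) {u π : V → ℝ} {i : V}
    (hu : ∀ j, 0 ≤ u j) (hπ : ∀ j, 0 ≤ π j) (hπ1 : ∑ j, π j = 1)
    (hlap : ∀ j, lap W u j = (if j = i then 1 else 0) - π j) {c : ℝ} (hc : 0 < c) :
    (∑ a, ∑ b, W a b * |u a - u b|) ^ 2 ≤
      (2 * Real.log ((∑ j, u j + c) / c)) * (2 * (D * (∑ j, u j + Fintype.card V * c))) := by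
  have hU : ∀ j, 0 < u j + c := fun j => by linarith [hu j]
  -- Each edge difference is bounded by the geometric mean of an entropy dissipation term and a mass
  -- term. The shift `c` keeps the logarithm finite where `u` vanishes.
  have hcs := Finset.sum_sq_le_sum_mul_sum_of_sq_le_mul (Finset.univ : Finset (V × V))
    (r := fun e => W e.1 e.2 * |u e.1 - u e.2|)
    (f := fun e => W e.1 e.2 *
      ((Real.log (u e.1 + c) - Real.log (u e.2 + c)) * (u e.1 - u e.2)))
    (g := fun e => W e.1 e.2 * ((u e.1 + c) + (u e.2 + c)))
    (fun e _ => ?_) (fun e _ => mul_nonneg (hW0 _ _) (add_pos (hU _) (hU _)).le) (fun e _ => ?_)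
  rotate_left
  · refine mul_nonneg (hW0 _ _) ?_
    rcases le_total (u e.1) (u e.2) with h | h
    · exact mul_nonneg_of_nonpos_of_nonpos
        (sub_nonpos.mpr (Real.log_le_log (hU _) (by linarith))) (by linarith)
    · exact mul_nonneg (sub_nonneg.mpr (Real.log_le_log (hU _) (by linarith))) (by linarith)
  · have h := sq_sub_le_mul_log_sub (hU e.1) (hU e.2)
    have h' := mul_le_mul_of_nonneg_left h (sq_nonneg (W e.1 e.2))
    rw [mul_pow, sq_abs]
    calc _ = W e.1 e.2 ^ 2 * (u e.1 + c - (u e.2 + c)) ^ 2 := by ring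
      _ ≤ _ := h'
      _ = _ := by ring
  simp only [Fintype.sum_prod_type] at hcs
  refine hcs.trans (mul_le_mul ?_ ?_ ?_ ?_)
  -- The dissipation factor is twice the pairing of `log (u + c)` with `lap u = 1_i - π`. It
  -- therefore costs only a logarithm.
  · have h1 := sum_mul_lap hW (fun j => Real.log (u j + c)) u
    have h2 : ∑ j, Real.log (u j + c) * lap W u j =
        Real.log (u i + c) - ∑ j, Real.log (u j + c) * π j := by
      simp [hlap, mul_sub, Finset.sum_sub_distrib]
    have h3 : Real.log c ≤ ∑ j, Real.log (u j + c) * π j := by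
      calc Real.log c = ∑ j, Real.log c * π j := by rw [← Finset.mul_sum, hπ1, mul_one]
        _ ≤ _ := Finset.sum_le_sum fun j _ => mul_le_mul_of_nonneg_right
            (Real.log_le_log hc (by linarith [hu j])) (hπ j)
    have h4 : Real.log (u i + c) ≤ Real.log (∑ j, u j + c) :=
      Real.log_le_log (hU i) (by
        have := Finset.single_le_sum (fun j _ => hu j) (Finset.mem_univ i)
        linarith)
    rw [Real.log_div (by have := Finset.sum_nonneg fun j (_ : j ∈ Finset.univ) => hu j
                         linarith) hc.ne']
    linarith
  · have h1 : ∑ a, ∑ b, W a b * (u a + c + (u b + c)) = 2 * ∑ a, (∑ b, W a b) * (u a + c) := by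
      have e1 : ∑ a, ∑ b, W a b * (u a + c + (u b + c)) =
          ∑ a, ∑ b, W a b * (u a + c) + ∑ a, ∑ b, W a b * (u b + c) := by
        simp only [← Finset.sum_add_distrib, mul_add]
      have e2 : ∑ a, ∑ b, W a b * (u b + c) = ∑ a, ∑ b, W a b * (u a + c) := by
        rw [Finset.sum_comm]
        exact Finset.sum_congr rfl fun a _ => Finset.sum_congr rfl fun b _ => by rw [hW]
      rw [e1, e2]
      simp only [Finset.sum_mul]; ring
    rw [h1]
    refine mul_le_mul_of_nonneg_left ?_ zero_le_two
    calc ∑ a, (∑ b, W a b) * (u a + c) ≤ ∑ a, D * (u a + c) :=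
          Finset.sum_le_sum fun a _ => mul_le_mul_of_nonneg_right (hD a) (hU a).le
      _ = _ := by rw [← Finset.mul_sum, Finset.sum_add_distrib]; simp
  · exact Finset.sum_nonneg fun a _ => Finset.sum_nonneg fun b _ =>
      mul_nonneg (hW0 _ _) (add_pos (hU _) (hU _)).le
  · have : 0 ≤ ∑ j, u j := Finset.sum_nonneg fun j _ => hu j
    have := Real.log_nonneg (x := (∑ j, u j + c) / c) (by rw [le_div_iff₀ hc]; linarith)
    linarith

/-- After centering `u`, Cauchy–Schwarz gives `E² ≤ ‖u - m‖² b`, while the gap gives `‖u - m‖² ≤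
E/Λ`. -/
lemma energy_le_of_sum_sq_lap_le {W : V → V → ℝ} (hW : ∀ i j, W i j = W j i)
    (hW0 : ∀ i j, 0 ≤ W i j) {Λ : ℝ} (hΛ : 0 < Λ)
    (hgap : ∀ x : V → ℝ, ∑ i, x i = 0 → Λ * ∑ i, x i ^ 2 ≤ ∑ i, x i * lap W x i)
    {u : V → ℝ} {b : ℝ} (hlap : ∑ j, lap W u j ^ 2 ≤ b) [Nonempty V] :
    ∑ j, u j * lap W u j ≤ b / Λ := by
  set m : ℝ := (∑ j, u j) / Fintype.card V
  have hV : (Fintype.card V : ℝ) ≠ 0 := by simp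
  have hm : ∑ j, (u j - m) = 0 := by
    simp [m, Finset.sum_sub_distrib]; field_simp; ring
  have h1 : ∑ j, (u j - m) * lap W u j = ∑ j, u j * lap W u j := by
    simp only [sub_mul, Finset.sum_sub_distrib, ← Finset.mul_sum, sum_lap hW]; simp
  have h2 := hgap (fun j => u j - m) hm
  simp only [lap_sub_const] at h2
  rw [h1] at h2
  have h3 := Finset.sum_mul_sq_le_sq_mul_sq Finset.univ (fun j => u j - m) (lap W u)
  rw [h1] at h3
  have hE := energy_nonneg hW hW0 u
  set E := ∑ j, u j * lap W u j
  set S := ∑ j, (u j - m) ^ 2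
  have hS : 0 ≤ S := Finset.sum_nonneg fun j _ => sq_nonneg _
  have h4 : E ^ 2 ≤ S * b := h3.trans (mul_le_mul_of_nonneg_left hlap hS)
  have hb : 0 ≤ b := (Finset.sum_nonneg fun j _ => sq_nonneg _).trans hlap
  rw [le_div_iff₀ hΛ]
  rcases hE.eq_or_lt with h | h
  · rw [← h]; simpa using hb
  · have : E * (E * Λ) ≤ E * b := by nlinarith
    exact le_of_mul_le_mul_left this h

end Laplacian

/-! ### Approximate Green's functions from the lazy walk. -/

section Potential

variable {V : Type*} [Fintype V] [DecidableEq V]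

lemma walk_iterate_nonneg {W : V → V → ℝ} (hW0 : ∀ i j, 0 ≤ W i j) {D : ℝ} (hD0 : 0 < D)
    (hD : ∀ i, ∑ j, W i j ≤ D) (i : V) (t : ℕ) (j : V) :
    0 ≤ (walk W D)^[t] (Pi.single i 1) j := by
  induction t generalizing j with
  | zero => by_cases h : j = i <;> simp [h]
  | succ t ih =>
    rw [Function.iterate_succ_apply']
    exact walk_nonneg hW0 hD0 hD ih j

lemma sum_walk_iterate {W : V → V → ℝ} (hW : ∀ i j, W i j = W j i) (D : ℝ) (i : V) (t : ℕ) :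
    ∑ j, (walk W D)^[t] (Pi.single i 1) j = 1 := by
  induction t with
  | zero => simp
  | succ t ih => rw [Function.iterate_succ_apply', sum_walk hW, ih]

lemma sum_sq_walk_iterate_sub_le [Nonempty V] {W : V → V → ℝ} (hW : ∀ i j, W i j = W j i)
    (hW0 : ∀ i j, 0 ≤ W i j) {D Λ : ℝ} (hD0 : 0 < D) (hD : ∀ i, ∑ j, W i j ≤ D)
    (hgap : ∀ x : V → ℝ, ∑ i, x i = 0 → Λ * ∑ i, x i ^ 2 ≤ ∑ i, x i * lap W x i)
    (i : V) (t : ℕ) :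
    ∑ j, ((walk W D)^[t] (Pi.single i 1) j - 1 / Fintype.card V) ^ 2 ≤
      Real.exp (-(Λ / (2 * D)) * t) := by
  have hV : (Fintype.card V : ℝ) ≠ 0 := by simp
  induction t with
  | zero =>
    have h1 : ∀ j, ((Pi.single i 1 : V → ℝ) j - 1 / Fintype.card V) ^ 2 =
        (Pi.single i 1 : V → ℝ) j * (1 - 2 / Fintype.card V) + (1 / Fintype.card V) ^ 2 := by
      intro j
      by_cases h : j = i
      · simp [h]; ring
      · simp [h]
    simp only [Function.iterate_zero, id, h1, Finset.sum_add_distrib, ← Finset.sum_mul]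
    simp only [Finset.sum_pi_single', Finset.mem_univ, if_true, Finset.sum_const, Finset.card_univ,
      nsmul_eq_mul, CharP.cast_eq_zero, mul_zero, Real.exp_zero]
    have : (0 : ℝ) ≤ 1 / Fintype.card V := by positivity
    have e : (Fintype.card V : ℝ) * (1 / Fintype.card V) ^ 2 = 1 / Fintype.card V := by
      field_simp
    rw [e]
    have e2 : (2 : ℝ) / Fintype.card V = 2 * (1 / Fintype.card V) := by ring
    rw [e2]; linarith
  | succ t ih =>
    have h0 : ∑ j, ((walk W D)^[t] (Pi.single i 1) j - 1 / Fintype.card V) = 0 := by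
      rw [Finset.sum_sub_distrib, sum_walk_iterate hW]; simp
    have h1 := sum_sq_walk_le hW hW0 hD0 hD hgap h0
    rw [walk_sub_const] at h1
    rw [Function.iterate_succ_apply']
    refine h1.trans ((mul_le_mul_of_nonneg_left ih (Real.exp_pos _).le).trans (le_of_eq ?_))
    rw [← Real.exp_add]; congr 1; push_cast; ring

/-- Approximate solution of the Poisson equation `lap u = 1_i - 1/n` with small energy and small
total variation. -/
theorem exists_potential {W : V → V → ℝ} (hW : ∀ i j, W i j = W j i) (hW0 : ∀ i j, 0 ≤ W i j)
    {D Λ : ℝ} (hD0 : 0 < D) (hΛ : 0 < Λ) (hD : ∀ i, ∑ j, W i j ≤ D)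
    (hgap : ∀ x : V → ℝ, ∑ i, x i = 0 → Λ * ∑ i, x i ^ 2 ≤ ∑ i, x i * lap W x i)
    (hcard : 2 ≤ Fintype.card V) (i : V) :
    ∃ u r : V → ℝ, (∀ j, lap W u j = (if j = i then 1 else 0) - 1 / Fintype.card V - r j) ∧
      ∑ j, |r j| ≤ 1 / 2 ∧ ∑ j, u j * lap W u j ≤ 2 / Λ ∧
      ∑ a, ∑ b, W a b * |u a - u b| ≤ 14 * Real.log (Fintype.card V) * √(D / Λ) := by
  have : Nonempty V := ⟨i⟩
  set n : ℝ := (Fintype.card V : ℝ) with hn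
  have hn2 : (2 : ℝ) ≤ n := by rw [hn]; exact_mod_cast hcard
  set m := Real.log (2 * n) with hm
  have hm1 : 1 ≤ m := by
    rw [hm, Real.le_log_iff_exp_le (by linarith)]
    have := Real.exp_one_lt_d9; linarith
  -- After `T` steps the squared `ℓ²` distance to uniform is at most `exp(-ΛT/(2D)) ≤ (2n)⁻²`, which
  -- leaves `ℓ¹` distance at most `1/2`.
  set T := ⌈4 * D * m / Λ⌉₊ with hT
  set p : ℕ → V → ℝ := fun t => (walk W D)^[t] (Pi.single i 1) with hp
  have hp0 : ∀ t j, 0 ≤ p t j := walk_iterate_nonneg hW0 hD0 hD i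
  have hp1 : ∀ t, ∑ j, p t j = 1 := sum_walk_iterate hW D i
  have hsucc : ∀ t j, p (t + 1) j = p t j - lap W (p t) j / (2 * D) := by
    intro t j; simp only [hp, Function.iterate_succ_apply']; rfl
  -- Since `lap p_t = 2D (p_t - p_{t+1})`, the Laplacian of this occupation sum telescopes to `p_0 -
  -- p_T`.
  set u : V → ℝ := fun j => 1 / (2 * D) * ∑ t ∈ Finset.range T, p t j with hu
  have hu0 : ∀ j, 0 ≤ u j := fun j =>
    mul_nonneg (by positivity) (Finset.sum_nonneg fun t _ => hp0 t j)
  have hlap : ∀ j, lap W u j = (if j = i then 1 else 0) - p T j := by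
    intro j
    have h1 : ∀ t, lap W (p t) j = 2 * D * (p t j - p (t + 1) j) := by
      intro t; rw [hsucc]; field_simp; ring
    rw [hu, lap_smul, lap_sum]
    simp only [h1, ← Finset.mul_sum, Finset.sum_range_sub']
    have : p 0 j = if j = i then 1 else 0 := by simp [hp, Pi.single_apply]
    rw [this]; field_simp
  have hsumu : ∑ j, u j = T / (2 * D) := by
    simp only [hu, ← Finset.mul_sum]
    rw [Finset.sum_comm]; simp [hp1]; ring
  have hΛD := gap_le_two_mul_degree hW hW0 hD0 hD hcard hgap
  have hτ : (T : ℝ) / (2 * D) ≤ 3 * m / Λ := by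
    have h1 : (T : ℝ) ≤ 4 * D * m / Λ + 1 := (Nat.ceil_lt_add_one (by positivity)).le
    -- The rounding error of the ceiling is absorbed using `Λ ≤ 2D` and `m ≥ 1`.
    have h2 : (1 : ℝ) ≤ 2 * D * m / Λ := by
      rw [le_div_iff₀ hΛ]; nlinarith
    rw [div_le_iff₀ (by positivity)]
    calc (T : ℝ) ≤ 4 * D * m / Λ + 2 * D * m / Λ := by linarith
      _ = _ := by field_simp; ring
  refine ⟨u, fun j => p T j - 1 / n, fun j => by rw [hlap]; ring, ?_, ?_, ?_⟩
  · have h1 := sum_sq_walk_iterate_sub_le hW hW0 hD0 hD hgap i T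
    have h2 : (∑ j, |p T j - 1 / n|) ^ 2 ≤ n * ∑ j, (p T j - 1 / n) ^ 2 := by
      have := Finset.sum_mul_sq_le_sq_mul_sq Finset.univ (fun _ => (1 : ℝ))
        (fun j => |p T j - 1 / n|)
      simpa [sq_abs] using this
    have h3 : Real.exp (-(Λ / (2 * D)) * T) ≤ 1 / (2 * n) ^ 2 := by
      have hT1 : 4 * D * m / Λ ≤ T := Nat.le_ceil _
      have : -(Λ / (2 * D)) * T ≤ -(2 * m) := by
        have := mul_le_mul_of_nonneg_left hT1 (by positivity : 0 ≤ Λ / (2 * D))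
        have e : Λ / (2 * D) * (4 * D * m / Λ) = 2 * m := by field_simp; ring
        linarith
      refine (Real.exp_le_exp.mpr this).trans (le_of_eq ?_)
      rw [Real.exp_neg, two_mul, Real.exp_add, hm, Real.exp_log (by linarith)]
      rw [one_div, sq]
    have h4 : (∑ j, |p T j - 1 / n|) ^ 2 ≤ (1 / 2) ^ 2 := by
      calc _ ≤ n * (1 / (2 * n) ^ 2) :=
            h2.trans (mul_le_mul_of_nonneg_left (h1.trans h3) (by linarith))
        _ = 1 / (4 * n) := by field_simp; ring
        _ ≤ 1 / 4 := by
            apply one_div_le_one_div_of_le <;> linarith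
        _ = _ := by norm_num
    exact le_of_sq_le_sq h4 (by norm_num)
  · refine energy_le_of_sum_sq_lap_le hW hW0 hΛ hgap ?_
    calc ∑ j, lap W u j ^ 2 ≤ ∑ j, ((if j = i then 1 else 0) + p T j) := by
          refine Finset.sum_le_sum fun j _ => ?_
          have hle : p T j ≤ 1 := by
            rw [← hp1 T]; exact Finset.single_le_sum (fun j _ => hp0 T j) (Finset.mem_univ j)
          have := hp0 T j
          rw [hlap]; split_ifs <;> nlinarith
      _ = 2 := by rw [Finset.sum_add_distrib, hp1]; simp; norm_num
  -- With the shift `c = 1/(nΛ)` the added mass `n c = 1/Λ` does not exceed the order `m/Λ` of the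
  -- mass of `u`, and the ratio inside the logarithm stays polynomial in `n`.
  · have hc : 0 < 1 / (n * Λ) := by positivity
    have h1 := sq_total_variation_le hW hW0 hD hu0 (hp0 T) (hp1 T) hlap hc
    rw [hsumu, ← hn] at h1
    have hlog : Real.log ((T / (2 * D) + 1 / (n * Λ)) / (1 / (n * Λ))) ≤ 3 * m := by
      have h2n : m ≤ 2 * n := by
        have := Real.log_le_sub_one_of_pos (by linarith : 0 < 2 * n); linarith
      calc Real.log ((T / (2 * D) + 1 / (n * Λ)) / (1 / (n * Λ)))
          ≤ Real.log ((2 * n) ^ 3) := by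
            apply Real.log_le_log (by positivity)
            rw [div_le_iff₀ hc]
            calc T / (2 * D) + 1 / (n * Λ) ≤ 3 * m / Λ + 1 / (n * Λ) := by linarith
              _ = (3 * m * n + 1) * (1 / (n * Λ)) := by field_simp
              _ ≤ _ := by
                refine mul_le_mul_of_nonneg_right ?_ hc.le
                have e1 : m * n ≤ 2 * n * n := mul_le_mul_of_nonneg_right h2n (by linarith)
                have e2 : 2 * n ^ 2 ≤ n ^ 3 := by
                  rw [pow_succ n 2, mul_comm]
                  exact mul_le_mul_of_nonneg_left hn2 (sq_nonneg n)
                nlinarith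
        _ = 3 * m := by rw [Real.log_pow]; norm_num [hm]
    have hsec : T / (2 * D) + n * (1 / (n * Λ)) ≤ 4 * m / Λ := by
      calc T / (2 * D) + n * (1 / (n * Λ)) ≤ 3 * m / Λ + 1 / Λ := by
            have : n * (1 / (n * Λ)) = 1 / Λ := by field_simp
            linarith
        _ = (3 * m + 1) / Λ := by ring
        _ ≤ _ := div_le_div_of_nonneg_right (by linarith) hΛ.le
    have h2m : m ≤ 2 * Real.log n := by
      rw [hm, Real.log_mul (by norm_num) (by linarith)]
      have := Real.log_le_log (by norm_num) hn2; linarith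
    refine le_of_sq_le_sq (h1.trans ?_) (by positivity)
    calc _ ≤ (2 * (3 * m)) * (2 * (D * (4 * m / Λ))) := by
          gcongr
      _ = 48 * m ^ 2 * (D / Λ) := by ring
      _ ≤ 48 * (2 * Real.log n) ^ 2 * (D / Λ) := by gcongr
      _ ≤ 196 * Real.log n ^ 2 * (D / Λ) := by
          have : 0 ≤ Real.log n ^ 2 * (D / Λ) := by positivity
          nlinarith
      _ = _ := by rw [mul_pow, mul_pow, Real.sq_sqrt (by positivity)]; norm_num

end Potential

/-! ### From edge expansion to a spectral gap without quadratic loss. -/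

section SpectralGap

variable {V : Type*} [Fintype V] [DecidableEq V]

lemma integral_indicator_Ioc_id {a b : ℝ} (h : a ≤ b) :
    ∫ t, (Set.Ioc a b).indicator id t = (b ^ 2 - a ^ 2) / 2 := by
  rw [integral_indicator measurableSet_Ioc, ← intervalIntegral.integral_of_le h]
  simp [integral_id]

lemma integrable_indicator_Ioc_id (a b : ℝ) : Integrable ((Set.Ioc a b).indicator id) :=
  (continuous_id.integrableOn_Ioc).integrable_indicator measurableSet_Ioc

/-- When `z ≤ y/2`, the difference `y - z` is at least `y/2`, so `y²/4 - z² ≤ (y - z)²`. Comparing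
levels a factor two apart is what makes the final bound linear in the expansion constant. -/
lemma integral_indicator_Ioc_half_le {y z : ℝ} (hy : 0 ≤ y) :
    ∫ t, (Set.Ioc z (y / 2)).indicator id t ≤ (if z ≤ y then (y - z) ^ 2 else 0) / 2 := by
  rcases le_total z (y / 2) with h | h
  · rw [integral_indicator_Ioc_id h, if_pos (by linarith)]
    nlinarith
  · rw [Set.Ioc_eq_empty (by linarith)]
    simp only [Set.indicator_empty, integral_zero]
    split_ifs <;> positivity

/-- Multi-scale Cheeger bound for nonnegative functions with small support. -/
lemma energy_ge_of_small_support {W : V → V → ℝ} (hW : ∀ i j, W i j = W j i)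
    (hW0 : ∀ i j, 0 ≤ W i j) {c : ℝ} (hc : 0 ≤ c)
    (hexp : ∀ A D : Finset V, A ⊆ D → 2 * D.card ≤ Fintype.card V → D.card ≤ 8 * A.card →
      c * A.card ≤ ∑ a ∈ A, ∑ b ∈ Dᶜ, W a b)
    {y : V → ℝ} (hy : ∀ i, 0 ≤ y i)
    (hsupp : 2 * (Finset.univ.filter fun i => 0 < y i).card ≤ Fintype.card V) :
    c / 8 * ∑ i, y i ^ 2 ≤ ∑ i, y i * lap W y i := by
  -- Layer-cake inequality at level `t`, with density `t dt`, for `A = {y ≥ 2t}` and `D = {y ≥ t}`.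
  -- Integrated, the left side is `c/8 · y² - c/16 · y²` at each vertex, that is `c/16 · y²`.
  have hpt : ∀ t : ℝ, ∑ a, (c * (Set.Ioc 0 (y a / 2)).indicator id t -
      c / 8 * (Set.Ioc 0 (y a)).indicator id t) ≤
      ∑ a, ∑ b, W a b * (Set.Ioc (y b) (y a / 2)).indicator id t := by
    intro t
    rcases le_or_gt t 0 with ht | ht
    · have h1 : ∀ a, (Set.Ioc 0 (y a / 2)).indicator (id : ℝ → ℝ) t = 0 := fun a =>
        Set.indicator_of_notMem (fun h => by linarith [h.1]) _
      have h2 : ∀ a, (Set.Ioc 0 (y a)).indicator (id : ℝ → ℝ) t = 0 := fun a =>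
        Set.indicator_of_notMem (fun h => by linarith [h.1]) _
      have h3 : ∀ a b, (Set.Ioc (y b) (y a / 2)).indicator (id : ℝ → ℝ) t = 0 := fun a b =>
        Set.indicator_of_notMem (fun h => by linarith [h.1, hy b]) _
      simp [h1, h2, h3]
    set A := Finset.univ.filter fun a => t ≤ y a / 2 with hA
    set D := Finset.univ.filter fun a => t ≤ y a with hD
    have hAD : A ⊆ D := fun a ha => by
      simp only [hA, hD, Finset.mem_filter, Finset.mem_univ, true_and] at ha ⊢
      linarith
    have hD2 : 2 * D.card ≤ Fintype.card V := by
      refine le_trans (Nat.mul_le_mul_left 2 (Finset.card_le_card fun a ha => ?_)) hsupp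
      simp only [hD, Finset.mem_filter, Finset.mem_univ, true_and] at ha ⊢
      linarith
    have e1 : ∑ a, (c * (Set.Ioc 0 (y a / 2)).indicator id t -
        c / 8 * (Set.Ioc 0 (y a)).indicator id t) = t * (c * A.card - c / 8 * D.card) := by
      rw [Finset.sum_sub_distrib, ← Finset.mul_sum, ← Finset.mul_sum]
      simp only [Set.indicator_apply, Set.mem_Ioc, ht, true_and, id, Finset.sum_ite,
        Finset.sum_const_zero, add_zero, Finset.sum_const, nsmul_eq_mul, ← hA, ← hD]
      ring
    have e2 : ∑ a, ∑ b, W a b * (Set.Ioc (y b) (y a / 2)).indicator id t =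
        t * ∑ a ∈ A, ∑ b ∈ Dᶜ, W a b := by
      have hDc : Dᶜ = Finset.univ.filter fun b => y b < t := by
        ext b; simp [hD]
      rw [hDc, hA, Finset.mul_sum, Finset.sum_filter]
      refine Finset.sum_congr rfl fun a _ => ?_
      rw [Finset.sum_filter]
      by_cases h : t ≤ y a / 2
      · rw [if_pos h, Finset.mul_sum]
        refine Finset.sum_congr rfl fun b _ => ?_
        by_cases h' : y b < t
        · simp [h, h', mul_comm]
        · simp [h']
      · simp [h]
    rw [e1, e2]
    refine mul_le_mul_of_nonneg_left ?_ ht.le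
    -- If `D` is more than eight times larger than `A`, expansion is unavailable, but then the left
    -- side is nonpositive.
    by_cases h8 : D.card ≤ 8 * A.card
    · have := hexp A D hAD hD2 h8
      have : 0 ≤ c / 8 * D.card := by positivity
      linarith
    · have h8' : (8 : ℝ) * A.card ≤ D.card := by exact_mod_cast (not_le.mp h8).le
      have : 0 ≤ ∑ a ∈ A, ∑ b ∈ Dᶜ, W a b :=
        Finset.sum_nonneg fun a _ => Finset.sum_nonneg fun b _ => hW0 a b
      nlinarith
  have hint := integral_mono (μ := volume) ?_ ?_ hpt
  · rw [integral_finsetSum, integral_finsetSum] at hint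
    · have hl : ∀ a, ∫ t, (c * (Set.Ioc 0 (y a / 2)).indicator id t -
          c / 8 * (Set.Ioc 0 (y a)).indicator id t) = c / 16 * y a ^ 2 := by
        intro a
        rw [integral_sub ((integrable_indicator_Ioc_id _ _).const_mul _)
          ((integrable_indicator_Ioc_id _ _).const_mul _), integral_const_mul, integral_const_mul,
          integral_indicator_Ioc_id (by linarith [hy a]), integral_indicator_Ioc_id (hy a)]
        ring
      have hr : ∀ a, ∫ t, ∑ b, W a b * (Set.Ioc (y b) (y a / 2)).indicator id t ≤
          ∑ b, W a b * ((if y b ≤ y a then (y a - y b) ^ 2 else 0) / 2) := by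
        intro a
        rw [integral_finsetSum _ fun b _ => (integrable_indicator_Ioc_id _ _).const_mul _]
        refine Finset.sum_le_sum fun b _ => ?_
        rw [integral_const_mul]
        exact mul_le_mul_of_nonneg_left (integral_indicator_Ioc_half_le (hy a)) (hW0 a b)
      simp only [hl, ← Finset.mul_sum] at hint
      have h2 := hint.trans (Finset.sum_le_sum fun a _ => hr a)
      have hsym : ∑ a, ∑ b, W a b * (if y b ≤ y a then (y a - y b) ^ 2 else 0) ≤
          ∑ i, y i * lap W y i := by
        rw [sum_mul_lap hW]
        have hs : ∑ a, ∑ b, W a b * (if y b ≤ y a then (y a - y b) ^ 2 else 0) =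
            ∑ a, ∑ b, W a b * (if y a ≤ y b then (y a - y b) ^ 2 else 0) := by
          rw [Finset.sum_comm]
          refine Finset.sum_congr rfl fun a _ => Finset.sum_congr rfl fun b _ => ?_
          rw [hW b a, ← neg_sub, neg_sq]
        have hadd : ∑ a, ∑ b, W a b * (if y b ≤ y a then (y a - y b) ^ 2 else 0) +
            ∑ a, ∑ b, W a b * (if y a ≤ y b then (y a - y b) ^ 2 else 0) ≤
            ∑ a, ∑ b, W a b * ((y a - y b) * (y a - y b)) := by
          rw [← Finset.sum_add_distrib]
          refine Finset.sum_le_sum fun a _ => ?_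
          rw [← Finset.sum_add_distrib]
          refine Finset.sum_le_sum fun b _ => ?_
          rw [← mul_add]
          refine mul_le_mul_of_nonneg_left ?_ (hW0 a b)
          rcases lt_trichotomy (y a) (y b) with h | h | h
          · rw [if_neg (not_le.mpr h), if_pos h.le]; nlinarith
          · simp [h]
          · rw [if_pos h.le, if_neg (not_le.mpr h)]; nlinarith
        linarith
      have hhalf : ∑ a, ∑ b, W a b * ((if y b ≤ y a then (y a - y b) ^ 2 else 0) / 2) =
          (∑ a, ∑ b, W a b * (if y b ≤ y a then (y a - y b) ^ 2 else 0)) / 2 := by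
        simp only [Finset.sum_div, mul_div_assoc]
      rw [hhalf] at h2
      linarith
    · exact fun a _ => integrable_finsetSum _ fun b _ =>
        (integrable_indicator_Ioc_id _ _).const_mul _
    · exact fun a _ => ((integrable_indicator_Ioc_id _ _).const_mul _).sub
        ((integrable_indicator_Ioc_id _ _).const_mul _)
  · exact integrable_finsetSum _ fun a _ => ((integrable_indicator_Ioc_id _ _).const_mul _).sub
        ((integrable_indicator_Ioc_id _ _).const_mul _)
  · exact integrable_finsetSum _ fun a _ => integrable_finsetSum _ fun b _ =>
        (integrable_indicator_Ioc_id _ _).const_mul _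

/-- The median is the least entry with at most half of the entries strictly above it. The next
smaller value has more than half strictly above it, and these are disjoint from the entries below
the median. -/
lemma exists_median [Nonempty V] (x : V → ℝ) :
    ∃ m : ℝ, 2 * (Finset.univ.filter fun i => m < x i).card ≤ Fintype.card V ∧
      2 * (Finset.univ.filter fun i => x i < m).card ≤ Fintype.card V := by
  set S := Finset.univ.filter fun i => 2 * (Finset.univ.filter fun j => x i < x j).card ≤
    Fintype.card V with hS
  have hSne : S.Nonempty := by
    obtain ⟨i, hi⟩ := Finite.exists_max x
    refine ⟨i, ?_⟩
    simp only [hS, Finset.mem_filter, Finset.mem_univ, true_and]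
    rw [Finset.filter_false_of_mem fun j _ => not_lt.mpr (hi j)]; simp
  obtain ⟨i, hiS, hi⟩ := S.exists_min_image x hSne
  refine ⟨x i, (Finset.mem_filter.mp hiS).2, ?_⟩
  set B := Finset.univ.filter fun j => x j < x i with hB
  rcases B.eq_empty_or_nonempty with h | h
  · simp [h]
  obtain ⟨j, hjB, hj⟩ := B.exists_max_image x h
  have hjS : j ∉ S := fun hjS => by
    have := hi j hjS
    have := (Finset.mem_filter.mp hjB).2
    linarith
  simp only [hS, Finset.mem_filter, Finset.mem_univ, true_and, not_le] at hjS
  have hdisj : Disjoint B (Finset.univ.filter fun k => x j < x k) := by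
    rw [Finset.disjoint_left]
    intro k hk hk'
    have := hj k hk
    have := (Finset.mem_filter.mp hk').2
    linarith
  have := Finset.card_le_univ (B ∪ Finset.univ.filter fun k => x j < x k)
  rw [Finset.card_union_of_disjoint hdisj] at this
  omega

/-- Expansion of small sets implies a spectral gap of the same order. -/
theorem spectral_gap_of_expansion [Nonempty V] {W : V → V → ℝ} (hW : ∀ i j, W i j = W j i)
    (hW0 : ∀ i j, 0 ≤ W i j) {c : ℝ} (hc : 0 ≤ c)
    (hexp : ∀ A D : Finset V, A ⊆ D → 2 * D.card ≤ Fintype.card V → D.card ≤ 8 * A.card →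
      c * A.card ≤ ∑ a ∈ A, ∑ b ∈ Dᶜ, W a b)
    (x : V → ℝ) (hx : ∑ i, x i = 0) :
    c / 8 * ∑ i, x i ^ 2 ≤ ∑ i, x i * lap W x i := by
  obtain ⟨m, hm1, hm2⟩ := exists_median x
  -- The positive and negative parts about the median each live on at most half the vertices, and
  -- their energies add up to at most that of `x`.
  have h1 := energy_ge_of_small_support hW hW0 hc hexp (y := fun i => max (x i - m) 0)
    (fun i => le_max_right _ _) (by simpa [lt_max_iff] using hm1)
  have h2 := energy_ge_of_small_support hW hW0 hc hexp (y := fun i => max (m - x i) 0)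
    (fun i => le_max_right _ _) (by simpa [lt_max_iff] using hm2)
  have h3 : ∑ i, x i ^ 2 ≤ ∑ i, max (x i - m) 0 ^ 2 + ∑ i, max (m - x i) 0 ^ 2 := by
    -- Since the entries of `x` sum to zero, moving the center to `m` can only increase the sum of
    -- squares.
    have : ∑ i, (x i ^ 2 - 2 * m * x i) ≤ ∑ i, (max (x i - m) 0 ^ 2 + max (m - x i) 0 ^ 2) := by
      refine Finset.sum_le_sum fun i _ => ?_
      rcases le_total (x i) m with h | h
      · rw [max_eq_right (by linarith), max_eq_left (by linarith)]; nlinarith [sq_nonneg m]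
      · rw [max_eq_left (by linarith), max_eq_right (by linarith)]; nlinarith [sq_nonneg m]
    rw [Finset.sum_sub_distrib, ← Finset.mul_sum, hx, Finset.sum_add_distrib] at this
    linarith
  have h4 : ∑ i, max (x i - m) 0 * lap W (fun i => max (x i - m) 0) i +
      ∑ i, max (m - x i) 0 * lap W (fun i => max (m - x i) 0) i ≤ ∑ i, x i * lap W x i := by
    rw [sum_mul_lap hW, sum_mul_lap hW, sum_mul_lap hW, ← mul_add]
    refine mul_le_mul_of_nonneg_left ?_ (by norm_num)
    rw [← Finset.sum_add_distrib]
    refine Finset.sum_le_sum fun i _ => ?_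
    rw [← Finset.sum_add_distrib]
    refine Finset.sum_le_sum fun j _ => ?_
    rw [← mul_add]
    refine mul_le_mul_of_nonneg_left ?_ (hW0 i j)
    rcases le_total (x i) m with h | h <;> rcases le_total (x j) m with h' | h' <;>
      simp only [max_eq_right, max_eq_left, sub_nonneg, sub_nonpos, h, h'] <;> nlinarith
  have h5 := mul_le_mul_of_nonneg_left h3 (by positivity : 0 ≤ c / 8)
  linarith

end SpectralGap

/-! ### The logistic function: curvature, Taylor remainder, convexity of the loss. -/

section Sigmoid

lemma winProb_eq_sigmoid {n : ℕ} (θ : Fin n → ℝ) (a b : Fin n) :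
    winProb θ a b = Real.sigmoid (θ a - θ b) := by
  rw [winProb, Real.sigmoid_def, neg_sub, Real.exp_sub]
  have := Real.exp_pos (θ a)
  have := Real.exp_pos (θ b)
  field_simp

/-- The derivative of the sigmoid. -/
def dsigmoid (z : ℝ) : ℝ := Real.sigmoid z * (1 - Real.sigmoid z)

lemma dsigmoid_pos (z : ℝ) : 0 < dsigmoid z :=
  mul_pos (Real.sigmoid_pos z) (by linarith [Real.sigmoid_lt_one z])

lemma dsigmoid_le_one (z : ℝ) : dsigmoid z ≤ 1 := by
  have := Real.sigmoid_pos z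
  have := Real.sigmoid_lt_one z
  unfold dsigmoid; nlinarith

lemma inv_four_mul_exp_le_dsigmoid {z b : ℝ} (h : |z| ≤ b) :
    1 / (4 * Real.exp b) ≤ dsigmoid z := by
  have key : ∀ z : ℝ, 0 ≤ z → z ≤ b → 1 / (4 * Real.exp b) ≤ dsigmoid z := by
    intro z hz hzb
    have h1 : 1 / 2 ≤ Real.sigmoid z := by
      have := Real.sigmoid_le hz; rw [Real.sigmoid_zero] at this; linarith
    have h2 : 1 - Real.sigmoid z = Real.sigmoid z * Real.exp (-z) := by
      rw [Real.sigmoid_mul_rexp_neg, Real.sigmoid_neg]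
    have h3 : Real.exp (-b) ≤ Real.exp (-z) := Real.exp_le_exp.mpr (by linarith)
    have h4 : (1 : ℝ) / (4 * Real.exp b) = 1 / 2 * (1 / 2 * Real.exp (-b)) := by
      rw [Real.exp_neg]; field_simp; norm_num
    rw [h4, dsigmoid, h2]
    gcongr
  rcases le_total 0 z with hz | hz
  · exact key z hz (by rwa [abs_of_nonneg hz] at h)
  · have := key (-z) (by linarith) (by rwa [abs_of_nonpos hz] at h)
    have e : dsigmoid (-z) = dsigmoid z := by
      simp only [dsigmoid, Real.sigmoid_neg]; ring
    rwa [e] at this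

/-- The remainder is relative to `dsigmoid z`: with `m = exp h - 1` it equals `dsigmoid z (m - h - s
m h) / (1 + s m)` exactly, with denominator at least `1/3`. The total variation in the curvature
weights can thus be used with no loss of a factor `κ`. -/
lemma abs_sigmoid_taylor_le {z h : ℝ} (hh : |h| ≤ 1) :
    |Real.sigmoid (z + h) - Real.sigmoid z - dsigmoid z * h| ≤ 9 * dsigmoid z * h ^ 2 := by
  set s := Real.sigmoid z with hs
  have hs0 : 0 < s := Real.sigmoid_pos z
  have hs1 : s < 1 := Real.sigmoid_lt_one z
  set m := Real.exp h - 1 with hm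
  have hden : 1 / 3 ≤ 1 + s * m := by
    have h1 : Real.exp (-1) ≤ Real.exp h := Real.exp_le_exp.mpr (by linarith [(abs_le.mp hh).1])
    have h2 : 1 / 3 ≤ Real.exp (-1) := by
      rw [Real.exp_neg, ← one_div]
      exact one_div_le_one_div_of_le (Real.exp_pos _) (by linarith [Real.exp_one_lt_d9])
    have : 1 / 3 ≤ 1 + m := by rw [hm]; linarith
    nlinarith
  have hform : Real.sigmoid (z + h) = s * Real.exp h / (1 + s * m) := by
    have e1 : 1 + s * m = s * Real.exp h + (1 - s) := by rw [hm]; ring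
    have e2 : 1 - s = s * Real.exp (-z) := by
      rw [hs, Real.sigmoid_mul_rexp_neg, Real.sigmoid_neg]
    rw [e1, e2, Real.sigmoid_def, neg_add, Real.exp_add, Real.exp_neg h]
    have := Real.exp_pos h
    have := Real.exp_pos (-z)
    field_simp
  have hrem : Real.sigmoid (z + h) - s - dsigmoid z * h =
      dsigmoid z * ((m - h - s * m * h) / (1 + s * m)) := by
    have : (1 + s * m) ≠ 0 := by linarith
    rw [hform, dsigmoid, ← hs]
    have e : Real.exp h = m + 1 := by rw [hm]; ring
    rw [e]; field_simp; ring
  have h1 : |m - h| ≤ h ^ 2 := by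
    have := Real.abs_exp_sub_one_sub_id_le hh; rwa [hm]
  have h2 : |m| ≤ 2 * |h| := by
    have := Real.abs_exp_sub_one_le hh; rwa [hm]
  have h3 : |m - h - s * m * h| ≤ 3 * h ^ 2 := by
    calc |m - h - s * m * h| ≤ |m - h| + |s * m * h| := abs_sub _ _
      _ ≤ h ^ 2 + 1 * (2 * |h|) * |h| := by
          rw [abs_mul, abs_mul, abs_of_pos hs0]
          gcongr
      _ = 3 * h ^ 2 := by rw [← sq_abs h]; ring
  rw [hrem, abs_mul, abs_of_pos (dsigmoid_pos z), abs_div, abs_of_pos (by linarith : 0 < 1 + s * m)]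
  have h4 : |m - h - s * m * h| / (1 + s * m) ≤ 9 * h ^ 2 := by
    rw [div_le_iff₀ (by linarith)]
    nlinarith [sq_nonneg h]
  calc _ ≤ dsigmoid z * (9 * h ^ 2) := mul_le_mul_of_nonneg_left h4 (dsigmoid_pos z).le
    _ = _ := by ring

/-- The negative log-likelihood of one comparison, as a function of the score difference. -/
def nll (b : Bool) (z : ℝ) : ℝ := -Real.log (if b then Real.sigmoid z else Real.sigmoid (-z))

/-- Strict Jensen for `exp` at `0` and `-(z' - z)` with weights `s` and `1 - s`; the average is
exactly `s / sigmoid z'`. Taking logarithms gives the tangent inequality. -/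
lemma nll_true_tangent_lt {z z' : ℝ} (h : z ≠ z') :
    nll true z + (Real.sigmoid z - 1) * (z' - z) < nll true z' := by
  set s := Real.sigmoid z with hs
  have hs0 : 0 < s := Real.sigmoid_pos z
  have hs1 : s < 1 := Real.sigmoid_lt_one z
  have hconv := strictConvexOn_exp.2 (Set.mem_univ 0) (Set.mem_univ (-(z' - z)))
    (by intro h'; apply h; linarith) hs0 (by linarith : 0 < 1 - s) (by ring)
  simp only [smul_eq_mul, mul_zero, zero_add, Real.exp_zero, mul_one] at hconv
  have hratio : s / Real.sigmoid z' = s + (1 - s) * Real.exp (-(z' - z)) := by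
    have e2 : 1 - s = s * Real.exp (-z) := by
      rw [hs, Real.sigmoid_mul_rexp_neg, Real.sigmoid_neg]
    rw [e2, Real.sigmoid_def z', div_inv_eq_mul, mul_assoc, ← Real.exp_add]
    rw [show -z + -(z' - z) = -z' by ring]; ring
  rw [← hratio] at hconv
  have hlog := Real.log_lt_log (Real.exp_pos _) hconv
  rw [Real.log_exp, Real.log_div hs0.ne' (Real.sigmoid_pos z').ne'] at hlog
  simp only [nll, if_true]
  linarith

lemma nll_tangent_lt (b : Bool) {z z' : ℝ} (h : z ≠ z') :
    nll b z + (Real.sigmoid z - if b then 1 else 0) * (z' - z) < nll b z' := by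
  cases b with
  | true => simpa using nll_true_tangent_lt h
  | false =>
    have := nll_true_tangent_lt (z := -z) (z' := -z') (by intro h'; apply h; linarith)
    rw [Real.sigmoid_neg] at this
    simp only [nll, if_true, Bool.false_eq_true, if_false] at this ⊢
    linarith

lemma nll_tangent_le (b : Bool) (z z' : ℝ) :
    nll b z + (Real.sigmoid z - if b then 1 else 0) * (z' - z) ≤ nll b z' := by
  rcases eq_or_ne z z' with h | h
  · simp [h]
  · exact (nll_tangent_lt b h).le

lemma continuous_nll (b : Bool) : Continuous (nll b) := by
  cases b with
  | true => exact (continuous_sigmoid.log fun z => (Real.sigmoid_pos z).ne').neg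
  | false =>
    exact ((continuous_sigmoid.comp continuous_neg).log fun z => (Real.sigmoid_pos (-z)).ne').neg

end Sigmoid

/-! ### Passage between sums over pairs and symmetric matrices. -/

section PairSums

variable {n : ℕ}

/-- The score difference across a pair. -/
def pairDiff (x : Fin n → ℝ) (e : Pair n) : ℝ := x e.1.2 - x e.1.1

/-- Weights on pairs as a strictly lower triangular matrix. -/
def lowerWeight (f : Pair n → ℝ) (i j : Fin n) : ℝ := if h : j < i then f ⟨(i, j), h⟩ else 0

/-- Weights on pairs as a symmetric matrix with zero diagonal. -/
def symWeight (f : Pair n → ℝ) (i j : Fin n) : ℝ := lowerWeight f i j + lowerWeight f j i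

lemma symWeight_comm (f : Pair n → ℝ) (i j : Fin n) : symWeight f i j = symWeight f j i :=
  add_comm _ _

lemma lowerWeight_nonneg {f : Pair n → ℝ} (hf : ∀ e, 0 ≤ f e) (i j : Fin n) :
    0 ≤ lowerWeight f i j := by
  unfold lowerWeight; split_ifs
  · exact hf _
  · exact le_rfl

lemma symWeight_nonneg {f : Pair n → ℝ} (hf : ∀ e, 0 ≤ f e) (i j : Fin n) :
    0 ≤ symWeight f i j :=
  add_nonneg (lowerWeight_nonneg hf i j) (lowerWeight_nonneg hf j i)

lemma symWeight_mono {f g : Pair n → ℝ} (h : ∀ e, f e ≤ g e) (i j : Fin n) :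
    symWeight f i j ≤ symWeight g i j := by
  unfold symWeight lowerWeight
  refine add_le_add ?_ ?_ <;> split_ifs <;> first | exact h _ | exact le_rfl

lemma sum_lowerWeight_mul (f : Pair n → ℝ) (F : Fin n → Fin n → ℝ) :
    ∑ i, ∑ j, lowerWeight f i j * F i j = ∑ e : Pair n, f e * F e.1.1 e.1.2 := by
  rw [← Fintype.sum_prod_type' (f := fun i j => lowerWeight f i j * F i j)]
  have h1 : ∀ e : Pair n, f e * F e.1.1 e.1.2 = lowerWeight f e.1.1 e.1.2 * F e.1.1 e.1.2 := by
    intro e; rw [lowerWeight, dif_pos e.2]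
  simp only [h1]
  rw [← Finset.sum_subtype (Finset.univ.filter fun e : Fin n × Fin n => e.2 < e.1) (by simp)
    (fun e : Fin n × Fin n => lowerWeight f e.1 e.2 * F e.1 e.2), Finset.sum_filter]
  refine Finset.sum_congr rfl fun e _ => ?_
  split_ifs with h
  · rfl
  · rw [lowerWeight, dif_neg h, zero_mul]

lemma sum_symWeight_mul (f : Pair n → ℝ) (F : Fin n → Fin n → ℝ) (hF : ∀ i j, F i j = F j i) :
    ∑ i, ∑ j, symWeight f i j * F i j = 2 * ∑ e : Pair n, f e * F e.1.1 e.1.2 := by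
  have h : ∑ i, ∑ j, lowerWeight f j i * F i j = ∑ i, ∑ j, lowerWeight f i j * F i j := by
    rw [Finset.sum_comm]
    exact Finset.sum_congr rfl fun i _ => Finset.sum_congr rfl fun j _ => by rw [hF]
  simp only [symWeight, add_mul, Finset.sum_add_distrib]
  rw [h, sum_lowerWeight_mul]; ring

lemma sum_mul_lap_symWeight (f : Pair n → ℝ) (a b : Fin n → ℝ) :
    ∑ i, a i * lap (symWeight f) b i = ∑ e : Pair n, f e * (pairDiff a e * pairDiff b e) := by
  rw [sum_mul_lap (symWeight_comm f), sum_symWeight_mul f _ fun i j => by ring, ← mul_assoc]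
  norm_num
  exact Finset.sum_congr rfl fun e _ => by simp only [pairDiff]; ring

/-- The vector with pairing `∑ e, s e * pairDiff a e` against every `a`. -/
def divergence (s : Pair n → ℝ) (i : Fin n) : ℝ :=
  ∑ e : Pair n, s e * ((if e.1.2 = i then 1 else 0) - if e.1.1 = i then 1 else 0)

lemma sum_mul_divergence (s : Pair n → ℝ) (a : Fin n → ℝ) :
    ∑ i, a i * divergence s i = ∑ e : Pair n, s e * pairDiff a e := by
  simp only [divergence, Finset.mul_sum]
  rw [Finset.sum_comm]
  refine Finset.sum_congr rfl fun e _ => ?_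
  calc ∑ i, a i * (s e * ((if e.1.2 = i then 1 else 0) - if e.1.1 = i then 1 else 0))
      = s e * (∑ i, a i * (if e.1.2 = i then 1 else 0) -
          ∑ i, a i * (if e.1.1 = i then 1 else 0)) := by
        rw [← Finset.sum_sub_distrib, Finset.mul_sum]
        exact Finset.sum_congr rfl fun i _ => by ring
    _ = _ := by simp [pairDiff]

lemma sum_divergence (s : Pair n → ℝ) : ∑ i, divergence s i = 0 := by
  have := sum_mul_divergence s fun _ => 1
  simpa [pairDiff] using this

end PairSums

/-- Adding the total sum to the Laplacian gives an injective, hence surjective, linear map. Summing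
coordinates shows that a zero-sum right side has a zero-sum preimage. -/
lemma exists_lap_eq {V : Type*} [Fintype V] [Nonempty V] {W : V → V → ℝ}
    (hW : ∀ i j, W i j = W j i) {Λ : ℝ} (hΛ : 0 < Λ)
    (hgap : ∀ x : V → ℝ, ∑ i, x i = 0 → Λ * ∑ i, x i ^ 2 ≤ ∑ i, x i * lap W x i)
    {b : V → ℝ} (hb : ∑ i, b i = 0) :
    ∃ x : V → ℝ, ∑ i, x i = 0 ∧ ∀ i, lap W x i = b i := by
  let T : (V → ℝ) →ₗ[ℝ] (V → ℝ) :=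
    { toFun := fun x i => lap W x i + ∑ j, x j
      map_add' := fun x y => by
        funext i
        have := lap_add W x y i
        simp only [Pi.add_apply, Finset.sum_add_distrib]
        rw [show x + y = fun j => x j + y j from rfl, this]; ring
      map_smul' := fun c x => by
        funext i
        have := lap_smul W c x i
        simp only [Pi.smul_apply, smul_eq_mul, RingHom.id_apply, ← Finset.mul_sum]
        rw [show c • x = fun j => c * x j from rfl, this]; ring }
  have hsum : ∀ x, ∑ i, T x i = Fintype.card V * ∑ j, x j := by
    intro x
    change ∑ i, (lap W x i + ∑ j, x j) = _
    rw [Finset.sum_add_distrib, sum_lap hW]; simp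
  have hV : (Fintype.card V : ℝ) ≠ 0 := by simp
  have hzero : ∀ x, ∑ i, T x i = 0 → ∑ j, x j = 0 := fun x h => by
    rw [hsum] at h; exact (mul_eq_zero.mp h).resolve_left hV
  have hinj : Function.Injective T := by
    rw [← LinearMap.ker_eq_bot, LinearMap.ker_eq_bot']
    intro x hx
    have hx0 : ∑ j, x j = 0 := hzero x (by simp [hx])
    have hl : ∀ i, lap W x i = 0 := fun i => by
      have : lap W x i + ∑ j, x j = 0 := congrFun hx i
      linarith
    have h1 := hgap x hx0
    simp only [hl, mul_zero, Finset.sum_const_zero] at h1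
    have h2 : ∑ i, x i ^ 2 = 0 :=
      le_antisymm (by nlinarith) (Finset.sum_nonneg fun i _ => sq_nonneg _)
    funext i
    have := (Finset.sum_eq_zero_iff_of_nonneg fun i _ => sq_nonneg (x i)).mp h2 i
      (Finset.mem_univ i)
    simpa using this
  obtain ⟨x, hx⟩ := (LinearMap.injective_iff_surjective.mp hinj) b
  have hx0 : ∑ j, x j = 0 := hzero x (by rw [hx, hb])
  refine ⟨x, hx0, fun i => ?_⟩
  have : lap W x i + ∑ j, x j = b i := congrFun hx i
  linarith

/-! ### Deterministic localization of the minimizer. -/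

section MLE

variable {n L : ℕ}

/-- The derivative of the loss with respect to the score difference across a pair. -/
def pairScore (w : Pair n → ℝ) (y : Pair n → Fin L → Bool) (x : Fin n → ℝ) (e : Pair n) : ℝ :=
  w e * (1 / L * ∑ l, (Real.sigmoid (pairDiff x e) - if y e l then 1 else 0))

lemma weightedLoss_eq (w : Pair n → ℝ) (y : Pair n → Fin L → Bool) (x : Fin n → ℝ) :
    weightedLoss w y x = ∑ e, ∑ l, 1 / L * (w e * nll (y e l) (pairDiff x e)) := by
  simp only [weightedLoss, Finset.mul_sum, winProb_eq_sigmoid]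
  refine Finset.sum_congr rfl fun e _ => Finset.sum_congr rfl fun l _ => ?_
  simp only [nll, pairDiff, neg_sub]; ring

lemma pairScore_mul (w : Pair n → ℝ) (y : Pair n → Fin L → Bool) (x : Fin n → ℝ) (e : Pair n)
    (h : ℝ) : pairScore w y x e * h =
      ∑ l, 1 / L * (w e * ((Real.sigmoid (pairDiff x e) - if y e l then 1 else 0) * h)) := by
  simp only [pairScore, Finset.mul_sum, Finset.sum_mul]
  exact Finset.sum_congr rfl fun l _ => by ring

lemma weightedLoss_tangent_le {w : Pair n → ℝ} (hw : ∀ e, 0 ≤ w e) (y : Pair n → Fin L → Bool)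
    (x x' : Fin n → ℝ) :
    weightedLoss w y x + ∑ e, pairScore w y x e * (pairDiff x' e - pairDiff x e) ≤
      weightedLoss w y x' := by
  simp only [weightedLoss_eq, pairScore_mul, ← Finset.sum_add_distrib]
  refine Finset.sum_le_sum fun e _ => Finset.sum_le_sum fun l _ => ?_
  rw [← mul_add, ← mul_add]
  have := nll_tangent_le (y e l) (pairDiff x e) (pairDiff x' e)
  have := hw e
  gcongr

lemma weightedLoss_tangent_lt {w : Pair n → ℝ} (hw : ∀ e, 0 ≤ w e) (hL : 0 < L)
    (y : Pair n → Fin L → Bool) {x x' : Fin n → ℝ} {e : Pair n} (he : 0 < w e)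
    (hne : pairDiff x e ≠ pairDiff x' e) :
    weightedLoss w y x + ∑ e, pairScore w y x e * (pairDiff x' e - pairDiff x e) <
      weightedLoss w y x' := by
  simp only [weightedLoss_eq, pairScore_mul, ← Finset.sum_add_distrib]
  refine Finset.sum_lt_sum (fun e _ => Finset.sum_le_sum fun l _ => ?_)
    ⟨e, Finset.mem_univ e, Finset.sum_lt_sum_of_nonempty ?_ fun l _ => ?_⟩
  · rw [← mul_add, ← mul_add]
    have := nll_tangent_le (y e l) (pairDiff x e) (pairDiff x' e)
    have := hw e
    gcongr
  · exact ⟨⟨0, hL⟩, Finset.mem_univ _⟩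
  · rw [← mul_add, ← mul_add]
    have := nll_tangent_lt (y e l) hne
    have : (0 : ℝ) < 1 / L := by positivity
    gcongr

lemma continuous_pairDiff (e : Pair n) : Continuous fun x : Fin n → ℝ => pairDiff x e := by
  unfold pairDiff; fun_prop

lemma continuous_weightedLoss (w : Pair n → ℝ) (y : Pair n → Fin L → Bool) :
    Continuous (weightedLoss w y) := by
  have : weightedLoss w y = fun x => ∑ e, ∑ l, 1 / L * (w e * nll (y e l) (pairDiff x e)) :=
    funext (weightedLoss_eq w y)
  rw [this]
  exact continuous_finsetSum _ fun e _ => continuous_finsetSum _ fun l _ =>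
    continuous_const.mul (continuous_const.mul ((continuous_nll _).comp (continuous_pairDiff e)))

lemma continuous_pairScore (w : Pair n → ℝ) (y : Pair n → Fin L → Bool) (e : Pair n) :
    Continuous fun x => pairScore w y x e := by
  unfold pairScore
  exact continuous_const.mul (continuous_const.mul (continuous_finsetSum _ fun l _ =>
    (continuous_sigmoid.comp (continuous_pairDiff e)).sub continuous_const))

lemma pairDiff_add_smul (x z : Fin n → ℝ) (t : ℝ) (e : Pair n) :
    pairDiff (x + t • z) e = pairDiff x e + t * pairDiff z e := by
  simp only [pairDiff, Pi.add_apply, Pi.smul_apply, smul_eq_mul]; ring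

/-- Curvature of the loss at `θ`. -/
def curvature (w : Pair n → ℝ) (θ : Fin n → ℝ) (e : Pair n) : ℝ :=
  w e * dsigmoid (pairDiff θ e)

/-- A minimizer along feasible segments has nonnegative directional derivative. -/
lemma sum_pairScore_mul_nonneg_of_le {w : Pair n → ℝ} (hw : ∀ e, 0 ≤ w e)
    (y : Pair n → Fin L → Bool) {x z : Fin n → ℝ}
    (hmin : ∀ t : ℝ, 0 < t → t ≤ 1 → weightedLoss w y x ≤ weightedLoss w y (x + t • z)) :
    0 ≤ ∑ e, pairScore w y x e * pairDiff z e := by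
  -- The tangent at the moved point, compared with the value at `x`, gives the sign for each `t >
  -- 0`. Continuity then carries it to `t = 0`, so no derivative of the loss is taken.
  have hpos : ∀ t : ℝ, 0 < t → t ≤ 1 →
      0 ≤ ∑ e, pairScore w y (x + t • z) e * pairDiff z e := by
    intro t ht ht1
    have h1 := weightedLoss_tangent_le hw y (x + t • z) x
    have h2 : ∑ e, pairScore w y (x + t • z) e * (pairDiff x e - pairDiff (x + t • z) e) =
        -t * ∑ e, pairScore w y (x + t • z) e * pairDiff z e := by
      rw [Finset.mul_sum]
      exact Finset.sum_congr rfl fun e _ => by rw [pairDiff_add_smul]; ring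
    rw [h2] at h1
    have h3 := hmin t ht ht1
    by_contra hneg
    push Not at hneg
    nlinarith
  have hcont : Continuous fun t : ℝ => ∑ e, pairScore w y (x + t • z) e * pairDiff z e :=
    continuous_finsetSum _ fun e _ =>
      ((continuous_pairScore w y e).comp (by fun_prop : Continuous fun t : ℝ => x + t • z)).mul
        continuous_const
  have hlim : Filter.Tendsto (fun t : ℝ => ∑ e, pairScore w y (x + t • z) e * pairDiff z e)
      (nhdsWithin 0 (Set.Ioi 0)) (nhds (∑ e, pairScore w y x e * pairDiff z e)) := by
    have := (hcont.tendsto 0).mono_left (nhdsWithin_le_nhds (s := Set.Ioi 0))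
    simpa using this
  refine ge_of_tendsto hlim ?_
  filter_upwards [Ioc_mem_nhdsGT (zero_lt_one (α := ℝ))] with t ht
  exact hpos t ht.1 ht.2

/-- The Newton step from a point of the box of radius `ε` around `θ` lands in the box of
radius `ε / 2`. -/
lemma newton_step_bound [NeZero n] {w : Pair n → ℝ} (hw : ∀ e, 0 ≤ w e) (hL : 0 < L)
    (y : Pair n → Fin L → Bool) {θ x z : Fin n → ℝ} {ε B : ℝ} (hε0 : 0 ≤ ε) (hε : ε ≤ 1 / 2)
    (hB : 144 * ε * B ≤ 1)
    (hpot : ∀ i, ∃ u r : Fin n → ℝ,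
      (∀ j, lap (symWeight (curvature w θ)) u j = (if j = i then 1 else 0) - 1 / n - r j) ∧
      ∑ j, |r j| ≤ 1 / 2 ∧
      ∑ a, ∑ b, symWeight (curvature w θ) a b * |u a - u b| ≤ B ∧
      |∑ e, pairScore w y θ e * pairDiff u e| ≤ ε / 8)
    (hx : ∀ i, |x i - θ i| ≤ ε) (hmean : ∑ i, (x i + z i - θ i) = 0)
    (hz : ∀ i, lap (symWeight (curvature w θ)) z i = -divergence (pairScore w y x) i) (i : Fin n) :
    |x i + z i - θ i| ≤ ε / 2 := by
  set δ : Fin n → ℝ := fun i => x i + z i - θ i with hδ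
  -- Testing at the largest coordinate allows the error `r` of its potential to be absorbed on the
  -- left.
  obtain ⟨k, hk⟩ := Finite.exists_max fun i => |δ i|
  refine (hk i).trans ?_
  obtain ⟨u, r, hlap, hr, hTV, hnoise⟩ := hpot k
  have hW := symWeight_comm (curvature w θ)
  have h1 : ∑ j, δ j * lap (symWeight (curvature w θ)) u j = δ k - ∑ j, δ j * r j := by
    simp only [hlap, mul_sub, Finset.sum_sub_distrib, ← Finset.sum_mul]
    rw [hmean]; simp
  -- By self-adjointness this is `lap (x - θ) - gradient(x)` paired with `u`. The linear part of the
  -- gradient increment cancels, leaving the Taylor remainder and the noise at `θ`.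
  have h2 : ∑ j, δ j * lap (symWeight (curvature w θ)) u j =
      -(∑ e, w e * (Real.sigmoid (pairDiff θ e + pairDiff (fun j => x j - θ j) e) -
        Real.sigmoid (pairDiff θ e) -
        dsigmoid (pairDiff θ e) * pairDiff (fun j => x j - θ j) e) * pairDiff u e) -
      ∑ e, pairScore w y θ e * pairDiff u e := by
    rw [sum_mul_lap_comm hW]
    have e1 : ∀ j, lap (symWeight (curvature w θ)) δ j =
        lap (symWeight (curvature w θ)) (fun j => x j - θ j) j +
          lap (symWeight (curvature w θ)) z j := by
      intro j
      rw [← lap_add]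
      congr 1
      funext l; simp only [hδ]; ring
    simp only [e1, hz, mul_add, mul_neg, Finset.sum_add_distrib, Finset.sum_neg_distrib]
    rw [sum_mul_divergence, sum_mul_lap_symWeight, ← sub_eq_add_neg, ← Finset.sum_sub_distrib,
      ← Finset.sum_neg_distrib, ← Finset.sum_sub_distrib]
    refine Finset.sum_congr rfl fun e _ => ?_
    have e2 : pairDiff θ e + pairDiff (fun j => x j - θ j) e = pairDiff x e := by
      simp only [pairDiff]; ring
    have e3 : pairScore w y x e = pairScore w y θ e +
        w e * (Real.sigmoid (pairDiff x e) - Real.sigmoid (pairDiff θ e)) := by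
      have hL' : (L : ℝ) ≠ 0 := by positivity
      simp only [pairScore, Finset.sum_sub_distrib, Finset.sum_const, Finset.card_univ,
        Fintype.card_fin, nsmul_eq_mul]
      field_simp; ring
    rw [e2, e3, curvature]; ring
  -- Score differences move by at most `2ε`, so the remainder is at most `36ε²` times the sum over
  -- pairs. That sum is half the double sum bounded by `B`, and `18ε²B ≤ ε/8`.
  have h3 : |∑ e, w e * (Real.sigmoid (pairDiff θ e + pairDiff (fun j => x j - θ j) e) -
        Real.sigmoid (pairDiff θ e) -
        dsigmoid (pairDiff θ e) * pairDiff (fun j => x j - θ j) e) * pairDiff u e| ≤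
      ε / 8 := by
    have hterm : ∀ e : Pair n, |w e *
        (Real.sigmoid (pairDiff θ e + pairDiff (fun j => x j - θ j) e) -
        Real.sigmoid (pairDiff θ e) -
        dsigmoid (pairDiff θ e) * pairDiff (fun j => x j - θ j) e) * pairDiff u e| ≤
        36 * ε ^ 2 * (curvature w θ e * |u e.1.1 - u e.1.2|) := by
      intro e
      have hd : |pairDiff (fun j => x j - θ j) e| ≤ 2 * ε := by
        have := abs_sub (x e.1.2 - θ e.1.2) (x e.1.1 - θ e.1.1)
        have := hx e.1.1
        have := hx e.1.2
        simp only [pairDiff]; linarith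
      have ht := abs_sigmoid_taylor_le (z := pairDiff θ e) (hd.trans (by linarith))
      have hsq : pairDiff (fun j => x j - θ j) e ^ 2 ≤ (2 * ε) ^ 2 := sq_le_sq.mpr (by
        rwa [abs_of_nonneg (by linarith : 0 ≤ 2 * ε)])
      have hds := (dsigmoid_pos (pairDiff θ e)).le
      rw [abs_mul, abs_mul, abs_of_nonneg (hw e), curvature, pairDiff, pairDiff, pairDiff,
        abs_sub_comm (u e.1.1)]
      calc _ ≤ w e * (9 * dsigmoid (pairDiff θ e) * (2 * ε) ^ 2) * |u e.1.2 - u e.1.1| := by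
            refine mul_le_mul_of_nonneg_right (mul_le_mul_of_nonneg_left (ht.trans ?_) (hw e))
              (abs_nonneg _)
            exact mul_le_mul_of_nonneg_left hsq (by positivity)
        _ = _ := by simp only [pairDiff]; ring
    refine (Finset.abs_sum_le_sum_abs _ _).trans ((Finset.sum_le_sum fun e _ => hterm e).trans ?_)
    rw [← Finset.mul_sum]
    rw [sum_symWeight_mul _ (fun a b => |u a - u b|) fun a b => abs_sub_comm _ _] at hTV
    have := mul_le_mul_of_nonneg_left hTV (by positivity : 0 ≤ 18 * ε ^ 2)
    have := mul_le_mul_of_nonneg_left hB (by positivity : 0 ≤ ε)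
    nlinarith
  have h4 : |∑ j, δ j * r j| ≤ |δ k| * (1 / 2) := by
    calc |∑ j, δ j * r j| ≤ ∑ j, |δ j * r j| := Finset.abs_sum_le_sum_abs _ _
      _ ≤ ∑ j, |δ k| * |r j| := Finset.sum_le_sum fun j _ => by
          rw [abs_mul]; exact mul_le_mul_of_nonneg_right (hk j) (abs_nonneg _)
      _ = |δ k| * ∑ j, |r j| := by rw [Finset.mul_sum]
      _ ≤ _ := mul_le_mul_of_nonneg_left hr (abs_nonneg _)
  rw [h1] at h2
  have h5 : |δ k| ≤ |δ k| * (1 / 2) + (ε / 8 + ε / 8) := by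
    have e : δ k = ∑ j, δ j * r j +
      (-(∑ e, w e * (Real.sigmoid (pairDiff θ e + pairDiff (fun j => x j - θ j) e) -
        Real.sigmoid (pairDiff θ e) -
        dsigmoid (pairDiff θ e) * pairDiff (fun j => x j - θ j) e) * pairDiff u e) -
      ∑ e, pairScore w y θ e * pairDiff u e) := by linarith
    conv_lhs => rw [e]
    refine (abs_add_le _ _).trans (add_le_add h4 ((abs_sub _ _).trans (add_le_add ?_ hnoise)))
    rwa [abs_neg]
  linarith

/-- Deterministic localization of the weighted maximum likelihood estimate. -/
theorem exists_weightedMLE_near [NeZero n] {w : Pair n → ℝ} (hw : ∀ e, 0 ≤ w e) (hL : 0 < L)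
    (y : Pair n → Fin L → Bool) {θ : Fin n → ℝ} (hθ : ∑ i, θ i = 0) {ε B Λ : ℝ}
    (hε0 : 0 ≤ ε) (hε : ε ≤ 1 / 2) (hB : 144 * ε * B ≤ 1) (hΛ : 0 < Λ)
    (hgap : ∀ x : Fin n → ℝ, ∑ i, x i = 0 →
      Λ * ∑ i, x i ^ 2 ≤ ∑ i, x i * lap (symWeight (curvature w θ)) x i)
    (hpot : ∀ i, ∃ u r : Fin n → ℝ,
      (∀ j, lap (symWeight (curvature w θ)) u j = (if j = i then 1 else 0) - 1 / n - r j) ∧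
      ∑ j, |r j| ≤ 1 / 2 ∧
      ∑ a, ∑ b, symWeight (curvature w θ) a b * |u a - u b| ≤ B ∧
      |∑ e, pairScore w y θ e * pairDiff u e| ≤ ε / 8) :
    ∃ x : Fin n → ℝ, IsWeightedMLE w y x ∧ ‖x - θ‖ ≤ ε ∧
      ∀ x', IsWeightedMLE w y x' → x' = x := by
  have hW := symWeight_comm (curvature w θ)
  set K : Set (Fin n → ℝ) := Metric.closedBall θ ε ∩ {x | ∑ i, x i = 0} with hK
  have hKc : IsCompact K := (isCompact_closedBall θ ε).inter_right
    (isClosed_eq (by fun_prop) continuous_const)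
  obtain ⟨x, hxK, hxmin⟩ := hKc.exists_isMinOn ⟨θ, Metric.mem_closedBall_self hε0, hθ⟩
    (continuous_weightedLoss w y).continuousOn
  have hmem : ∀ x : Fin n → ℝ, x ∈ Metric.closedBall θ ε ↔ ∀ i, |x i - θ i| ≤ ε := by
    intro x
    rw [Metric.mem_closedBall, dist_pi_le_iff hε0]; rfl
  have hx0 : ∑ i, x i = 0 := hxK.2
  have hxε := (hmem x).mp hxK.1
  obtain ⟨z, hz0, hz⟩ := exists_lap_eq hW hΛ hgap
    (b := fun i => -divergence (pairScore w y x) i) (by simp [sum_divergence])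
  have hnewton := newton_step_bound hw hL y hε0 hε hB hpot hxε
    (by simp [Finset.sum_sub_distrib, Finset.sum_add_distrib, hx0, hz0, hθ]) hz
  -- The segment from `x` to `x + z` stays in the box by convexity, even when `x` lies on its
  -- boundary.
  have hdir := sum_pairScore_mul_nonneg_of_le hw y (x := x) (z := z) fun t ht ht1 => by
    refine hxmin ⟨(hmem _).mpr fun i => ?_, ?_⟩
    · have e : (x + t • z) i - θ i = (1 - t) * (x i - θ i) + t * (x i + z i - θ i) := by
        simp only [Pi.add_apply, Pi.smul_apply, smul_eq_mul]; ring
      rw [e]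
      refine (abs_add_le _ _).trans ?_
      rw [abs_mul, abs_mul, abs_of_pos ht, abs_of_nonneg (by linarith : 0 ≤ 1 - t)]
      have h1 := mul_le_mul_of_nonneg_left (hxε i) (by linarith : 0 ≤ 1 - t)
      have h2 := mul_le_mul_of_nonneg_left (hnewton i) ht.le
      nlinarith
    · simp [Finset.sum_add_distrib, hx0, ← Finset.mul_sum, hz0]
  -- The directional derivative along `z` is minus the energy of `z`, so its nonnegativity leaves no
  -- energy.
  have hzE : ∑ i, z i * lap (symWeight (curvature w θ)) z i ≤ 0 := by
    simp only [hz, mul_neg, Finset.sum_neg_distrib]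
    rw [sum_mul_divergence]; linarith
  have hzero_of : ∀ v : Fin n → ℝ, ∑ i, v i = 0 →
      ∑ i, v i * lap (symWeight (curvature w θ)) v i ≤ 0 → ∀ i, v i = 0 := by
    intro v hv0 hvE i
    have h1 := hgap v hv0
    have h2 : ∑ i, v i ^ 2 = 0 :=
      le_antisymm (by nlinarith) (Finset.sum_nonneg fun i _ => sq_nonneg _)
    have := (Finset.sum_eq_zero_iff_of_nonneg fun i _ => sq_nonneg (v i)).mp h2 i
      (Finset.mem_univ i)
    simpa using this
  have hzz := hzero_of z hz0 hzE
  have hgrad : ∀ a : Fin n → ℝ, ∑ e, pairScore w y x e * pairDiff a e = 0 := by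
    intro a
    have hd : ∀ i, divergence (pairScore w y x) i = 0 := by
      intro i
      have h := hz i
      simp only [lap, hzz, sub_self, mul_zero, Finset.sum_const_zero] at h
      linarith
    rw [← sum_mul_divergence]; simp [hd]
  have hcross : ∀ x', ∑ e, pairScore w y x e * (pairDiff x' e - pairDiff x e) = 0 := by
    intro x'
    simp only [mul_sub, Finset.sum_sub_distrib, hgrad, sub_self]
  refine ⟨x, ⟨hx0, fun x' _ => ?_⟩, ?_, fun x' hx' => ?_⟩
  · have := weightedLoss_tangent_le hw y x x'
    rw [hcross] at this; linarith
  · rw [← dist_eq_norm]; exact hxK.1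
  · have hle := hx'.2 x hx0
    -- A second minimizer has the same difference across every edge of positive weight. The gap then
    -- identifies the two.
    have heq : ∀ e, w e * pairDiff (fun i => x' i - x i) e = 0 := by
      intro e
      by_contra hne
      have hwe : 0 < w e := lt_of_le_of_ne (hw e) fun h => hne (by rw [← h, zero_mul])
      have hpd : pairDiff x e ≠ pairDiff x' e := fun h => hne (by
        simp only [pairDiff] at h ⊢
        rw [show x' e.1.2 - x e.1.2 - (x' e.1.1 - x e.1.1) = 0 by linarith, mul_zero])
      have := weightedLoss_tangent_lt hw hL y hwe hpd
      rw [hcross] at this; linarith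
    have hE : ∑ i, (x' i - x i) * lap (symWeight (curvature w θ)) (fun i => x' i - x i) i ≤ 0 := by
      rw [sum_mul_lap_symWeight (curvature w θ) (fun i => x' i - x i)]
      refine le_of_eq (Finset.sum_eq_zero fun e _ => ?_)
      rw [curvature]
      linear_combination (dsigmoid (pairDiff θ e) * pairDiff (fun i => x' i - x i) e) * heq e
    funext i
    have := hzero_of (fun i => x' i - x i)
      (by simp [Finset.sum_sub_distrib, hx0, hx'.1]) hE i
    linarith

end MLE

/-! ### From sup-norm error to exact top-`K` recovery. -/

section TopK

lemma recoversTopK_of_separated {n K : ℕ} (hK : K ≤ n) {x : Fin n → ℝ}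
    (h : ∀ i j : Fin n, (i : ℕ) < K → K ≤ (j : ℕ) → x j < x i) : RecoversTopK x K := by
  intro S
  have hcard : (Finset.univ.filter fun i : Fin n => (i : ℕ) < K).card = K := by
    rw [Fin.card_filter_val_lt, min_eq_right hK]
  constructor
  · rintro ⟨hS, htop⟩
    refine Finset.eq_of_subset_of_card_le (fun i hi => ?_) (by rw [hcard, hS])
    by_contra hiK
    simp only [Finset.mem_filter, Finset.mem_univ, true_and, not_lt] at hiK
    have hne : ∃ j : Fin n, (j : ℕ) < K ∧ j ∉ S := by
      by_contra hall
      push Not at hall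
      have hss : (Finset.univ.filter fun i : Fin n => (i : ℕ) < K) ⊂ S := by
        refine ⟨fun j hj => hall j (Finset.mem_filter.mp hj).2, fun hsub => ?_⟩
        have := (Finset.mem_filter.mp (hsub hi)).2
        omega
      have := Finset.card_lt_card hss
      omega
    obtain ⟨j, hjK, hjS⟩ := hne
    have := htop i hi j hjS
    have := h j i hjK hiK
    linarith
  · rintro rfl
    refine ⟨hcard, fun i hi j hj => ?_⟩
    simp only [Finset.mem_filter, Finset.mem_univ, true_and, not_lt] at hi hj
    exact (h i j hi hj).le

lemma recoversTopK_of_norm_sub_le {n K : ℕ} (hK1 : 1 ≤ K) (hKn : K < n) {x θ : Fin n → ℝ}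
    (hθ : Antitone θ) {ε : ℝ} (hx : ‖x - θ‖ ≤ ε) (hgap : 2 * ε < scoreGap θ K hKn) :
    RecoversTopK x K := by
  refine recoversTopK_of_separated hKn.le fun i j hi hj => ?_
  have h1 : ∀ i, |x i - θ i| ≤ ε := fun i => (norm_le_pi_norm (x - θ) i).trans hx
  have h2 : θ ⟨K - 1, lt_of_le_of_lt (Nat.sub_le K 1) hKn⟩ ≤ θ i :=
    hθ (Fin.le_def.mpr (by dsimp only; omega) : i ≤ ⟨K - 1, _⟩)
  have h3 : θ j ≤ θ ⟨K, hKn⟩ := hθ (Fin.mk_le_mk.mpr hj : (⟨K, hKn⟩ : Fin n) ≤ j)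
  have h4 := (abs_le.mp (h1 i)).1
  have h5 := (abs_le.mp (h1 j)).2
  unfold scoreGap at hgap
  linarith

end TopK

/-! ### Chernoff, Hoeffding, and conditioning on the graph. -/

section Concentration

variable {Ω : Type*} [MeasurableSpace Ω] {μ : Measure Ω}

/-- The indicator of a Boolean, as a real number. -/
def indR (b : Bool) : ℝ := if b then 1 else 0

lemma measurable_indR : Measurable indR := measurable_of_finite _

lemma indR_nonneg (b : Bool) : 0 ≤ indR b := by cases b <;> simp [indR]

lemma indR_le_one (b : Bool) : indR b ≤ 1 := by cases b <;> simp [indR]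

lemma integral_indR {b : Ω → Bool} (hb : Measurable b) :
    ∫ ω, indR (b ω) ∂μ = μ.real {ω | b ω = true} := by
  have hs : MeasurableSet {ω | b ω = true} := hb (measurableSet_singleton true)
  rw [← integral_indicator_one hs]
  congr 1
  funext ω
  by_cases h : b ω = true <;> simp [indR, h]

variable [IsProbabilityMeasure μ]

/-- `1 + x ≤ exp x` compares the Bernoulli moment generating function with the Poisson one of the
same mean. -/
lemma mgf_indR_le {b : Ω → Bool} (hb : Measurable b) (t : ℝ) :
    mgf (fun ω => indR (b ω)) μ t ≤
      Real.exp (μ.real {ω | b ω = true} * (Real.exp t - 1)) := by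
  have hint : Integrable (fun ω => indR (b ω)) μ :=
    Integrable.of_mem_Icc 0 1 (measurable_indR.comp hb).aemeasurable
      (ae_of_all _ fun ω => ⟨indR_nonneg _, indR_le_one _⟩)
  have h1 : ∀ ω, Real.exp (t * indR (b ω)) = 1 + (Real.exp t - 1) * indR (b ω) := by
    intro ω
    cases b ω <;> simp [indR]
  rw [mgf]
  simp only [h1]
  rw [integral_add (integrable_const _) (hint.const_mul _), integral_const_mul, integral_indR hb]
  simp only [integral_const, probReal_univ, smul_eq_mul, mul_one]
  have := Real.add_one_le_exp (μ.real {ω | b ω = true} * (Real.exp t - 1))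
  linarith

variable {ι : Type*} {b : ι → Ω → Bool}

lemma mgf_sum_indR_le (hb : ∀ i, Measurable (b i)) (hind : iIndepFun b μ) (S : Finset ι) (t : ℝ) :
    mgf (∑ i ∈ S, fun ω => indR (b i ω)) μ t ≤
      Real.exp ((∑ i ∈ S, μ.real {ω | b i ω = true}) * (Real.exp t - 1)) := by
  have hind' : iIndepFun (fun i ω => indR (b i ω)) μ := hind.comp (fun _ => indR)
    fun _ => measurable_indR
  rw [hind'.mgf_sum (fun i => measurable_indR.comp (hb i)), Finset.sum_mul, Real.exp_sum]
  exact Finset.prod_le_prod (fun i _ => mgf_nonneg) fun i _ => mgf_indR_le (hb i) t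

lemma integrable_exp_sum_indR (hb : ∀ i, Measurable (b i)) (S : Finset ι) (t : ℝ) :
    Integrable (fun ω => Real.exp (t * (∑ i ∈ S, fun ω => indR (b i ω)) ω)) μ := by
  refine Integrable.of_bound (C := Real.exp (|t| * S.card)) ?_ (ae_of_all _ fun ω => ?_)
  · refine (Real.measurable_exp.comp (measurable_const.mul ?_)).aestronglyMeasurable
    have : Measurable fun ω => ∑ i ∈ S, indR (b i ω) :=
      Finset.measurable_sum _ fun i _ => measurable_indR.comp (hb i)
    convert this using 1
    funext ω; simp
  · rw [Real.norm_eq_abs, Real.abs_exp, Finset.sum_apply]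
    refine Real.exp_le_exp.mpr ?_
    have h0 : 0 ≤ ∑ i ∈ S, indR (b i ω) := Finset.sum_nonneg fun i _ => indR_nonneg _
    have h1 : ∑ i ∈ S, indR (b i ω) ≤ S.card := by
      have := Finset.sum_le_card_nsmul S (fun i => indR (b i ω)) 1 fun i _ => indR_le_one _
      simpa using this
    calc t * ∑ i ∈ S, indR (b i ω) ≤ |t| * ∑ i ∈ S, indR (b i ω) :=
          mul_le_mul_of_nonneg_right (le_abs_self t) h0
      _ ≤ _ := mul_le_mul_of_nonneg_left h1 (abs_nonneg t)

/-- Chernoff bound for the lower tail of a sum of independent indicators. -/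
lemma chernoff_lower (hb : ∀ i, Measurable (b i)) (hind : iIndepFun b μ) (S : Finset ι) {q : ℝ}
    (hq0 : 0 ≤ q) (hq : ∀ i ∈ S, q ≤ μ.real {ω | b i ω = true}) :
    μ.real {ω | ∑ i ∈ S, indR (b i ω) ≤ q * S.card / 2} ≤ Real.exp (-(q * S.card / 8)) := by
  have h := measure_le_le_exp_mul_mgf (q * S.card / 2) (by norm_num : (-1 : ℝ) ≤ 0)
    (integrable_exp_sum_indR (μ := μ) hb S (-1))
  simp only [Finset.sum_apply] at h
  refine h.trans ((mul_le_mul_of_nonneg_left (mgf_sum_indR_le hb hind S (-1))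
    (Real.exp_pos _).le).trans ?_)
  rw [← Real.exp_add]
  refine Real.exp_le_exp.mpr ?_
  have hsum : q * S.card ≤ ∑ i ∈ S, μ.real {ω | b i ω = true} := by
    have := Finset.card_nsmul_le_sum S (fun i => μ.real {ω | b i ω = true}) q hq
    rw [nsmul_eq_mul] at this; linarith
  -- At `t = -1` the exponent is at most `q|S| (1/2 - 5/8) = -q|S|/8`.
  have he : Real.exp (-1) - 1 ≤ -(5 / 8) := by
    have : Real.exp (-1) ≤ 3 / 8 := by
      rw [Real.exp_neg, inv_le_comm₀ (Real.exp_pos _) (by norm_num)]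
      have := Real.exp_one_gt_d9; norm_num; linarith
    linarith
  have h0 : 0 ≤ q * S.card := by positivity
  nlinarith

/-- Chernoff bound for the upper tail of a sum of independent indicators. -/
lemma chernoff_upper (hb : ∀ i, Measurable (b i)) (hind : iIndepFun b μ) (S : Finset ι) {M : ℝ}
    (hM : ∑ i ∈ S, μ.real {ω | b i ω = true} ≤ M) :
    μ.real {ω | 4 * M ≤ ∑ i ∈ S, indR (b i ω)} ≤ Real.exp (-(2 * M)) := by
  have h := measure_ge_le_exp_mul_mgf (4 * M) (by norm_num : (0 : ℝ) ≤ 1)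
    (integrable_exp_sum_indR (μ := μ) hb S 1)
  simp only [Finset.sum_apply] at h
  refine h.trans ((mul_le_mul_of_nonneg_left (mgf_sum_indR_le hb hind S 1)
    (Real.exp_pos _).le).trans ?_)
  rw [← Real.exp_add]
  refine Real.exp_le_exp.mpr ?_
  have h0 : 0 ≤ ∑ i ∈ S, μ.real {ω | b i ω = true} :=
    Finset.sum_nonneg fun i _ => measureReal_nonneg
  have he : Real.exp 1 - 1 ≤ 2 := by linarith [Real.exp_one_lt_d9]
  nlinarith

/-- Hoeffding's inequality for weighted sums of centered independent indicators. -/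
lemma hoeffding_indR [Fintype ι] (hb : ∀ i, Measurable (b i)) (hind : iIndepFun b μ)
    (c : ι → ℝ) {v s : ℝ} (hv : ∑ i, c i ^ 2 ≤ v) (hs : 0 ≤ s) :
    μ.real {ω | s ≤ ∑ i, c i * (indR (b i ω) - μ.real {ω | b i ω = true})} ≤
      Real.exp (-(2 * s ^ 2 / v)) := by
  have hv0 : 0 ≤ v := (Finset.sum_nonneg fun i _ => sq_nonneg (c i)).trans hv
  have hsub : ∀ i, HasSubgaussianMGF
      (fun ω => c i * (indR (b i ω) - μ.real {ω | b i ω = true}))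
      (NNReal.mk (c i ^ 2) (sq_nonneg _) * (‖(1 : ℝ) - 0‖₊ / 2) ^ 2) μ := by
    intro i
    have h := hasSubgaussianMGF_of_mem_Icc (μ := μ) (X := fun ω => indR (b i ω)) (a := 0) (b := 1)
      (measurable_indR.comp (hb i)).aemeasurable
      (ae_of_all _ fun ω => ⟨indR_nonneg _, indR_le_one _⟩)
    rw [integral_indR (hb i)] at h
    exact h.const_mul (c i)
  have hind' : iIndepFun (fun i ω => c i * (indR (b i ω) - μ.real {ω | b i ω = true})) μ :=
    hind.comp (fun i x => c i * (indR x - μ.real {ω | b i ω = true}))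
      fun i => measurable_of_finite _
  have hsum := HasSubgaussianMGF.sum_of_iIndepFun hind' (s := Finset.univ) fun i _ => hsub i
  have hcoe : ((∑ i, NNReal.mk (c i ^ 2) (sq_nonneg _) * (‖(1 : ℝ) - 0‖₊ / 2) ^ 2 : NNReal) : ℝ) =
      (∑ i, c i ^ 2) / 4 := by
    rw [NNReal.coe_sum, Finset.sum_div]
    refine Finset.sum_congr rfl fun i _ => ?_
    rw [NNReal.coe_mul, NNReal.coe_pow, NNReal.coe_div, coe_nnnorm, sub_zero, norm_one]
    change c i ^ 2 * (1 / 2) ^ 2 = _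
    ring
  have hbig : HasSubgaussianMGF
      (fun ω => ∑ i, c i * (indR (b i ω) - μ.real {ω | b i ω = true}))
      (NNReal.mk (v / 4) (by positivity)) μ := by
    refine ⟨hsum.integrable_exp_mul, fun t => (hsum.mgf_le t).trans (Real.exp_le_exp.mpr ?_)⟩
    rw [hcoe]
    change (∑ i, c i ^ 2) / 4 * t ^ 2 / 2 ≤ v / 4 * t ^ 2 / 2
    gcongr
  refine (hbig.measure_ge_le hs).trans (le_of_eq ?_)
  change Real.exp (-s ^ 2 / (2 * (v / 4))) = _
  congr 1
  -- When `v = 0`, division by zero makes both exponents `0`, and the bound is the trivial `1`.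
  rcases hv0.eq_or_lt with h | h
  · simp [← h]
  · field_simp; ring

lemma hoeffding_abs_indR [Fintype ι] (hb : ∀ i, Measurable (b i)) (hind : iIndepFun b μ)
    (c : ι → ℝ) {v s : ℝ} (hv : ∑ i, c i ^ 2 ≤ v) (hs : 0 ≤ s) :
    μ.real {ω | s ≤ |∑ i, c i * (indR (b i ω) - μ.real {ω | b i ω = true})|} ≤
      2 * Real.exp (-(2 * s ^ 2 / v)) := by
  have h1 := hoeffding_indR hb hind c hv hs
  have h2 := hoeffding_indR hb hind (fun i => -c i) (by simpa using hv) hs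
  have hsub : {ω | s ≤ |∑ i, c i * (indR (b i ω) - μ.real {ω | b i ω = true})|} ⊆
      {ω | s ≤ ∑ i, c i * (indR (b i ω) - μ.real {ω | b i ω = true})} ∪
      {ω | s ≤ ∑ i, -c i * (indR (b i ω) - μ.real {ω | b i ω = true})} := by
    intro ω hω
    simp only [Set.mem_ofPred_eq, Set.mem_union, neg_mul, Finset.sum_neg_distrib] at hω ⊢
    exact le_abs.mp hω
  have h3 := (measureReal_mono (μ := μ) hsub).trans (measureReal_union_le _ _)
  linarith

/-- Conditioning on one of two independent finite random variables. -/
lemma measureReal_mem_and_le_of_indepFun {α β : Type*} [Fintype α] [MeasurableSpace α]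
    [MeasurableSingletonClass α] [MeasurableSpace β] [DiscreteMeasurableSpace β]
    {X : Ω → α} {Y : Ω → β} (hX : Measurable X) (hXY : IndepFun X Y μ) (G : Set α)
    (B : α → Set β) {η : ℝ} (hη : 0 ≤ η) (h : ∀ g ∈ G, μ.real (Y ⁻¹' B g) ≤ η) :
    μ.real {ω | X ω ∈ G ∧ Y ω ∈ B (X ω)} ≤ η := by
  classical
  have hsub : {ω | X ω ∈ G ∧ Y ω ∈ B (X ω)} ⊆
      ⋃ g : α, (if g ∈ G then X ⁻¹' {g} ∩ Y ⁻¹' B g else ∅) := by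
    intro ω hω
    refine Set.mem_iUnion.mpr ⟨X ω, ?_⟩
    rw [if_pos hω.1]
    exact ⟨rfl, hω.2⟩
  refine (measureReal_mono hsub).trans ((measureReal_iUnion_fintype_le _).trans ?_)
  calc ∑ g, μ.real (if g ∈ G then X ⁻¹' {g} ∩ Y ⁻¹' B g else ∅)
      ≤ ∑ g, μ.real (X ⁻¹' {g}) * η := by
        refine Finset.sum_le_sum fun g _ => ?_
        split_ifs with hg
        · rw [measureReal_def, hXY.measure_inter_preimage_eq_mul _ _ (measurableSet_singleton g)
            (MeasurableSet.of_discrete), ENNReal.toReal_mul]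
          exact mul_le_mul_of_nonneg_left (h g hg) ENNReal.toReal_nonneg
        · simp only [measureReal_empty]
          exact mul_nonneg measureReal_nonneg hη
    _ = η := by
        rw [← Finset.sum_mul, sum_measureReal_preimage_singleton _
          fun g _ => hX (measurableSet_singleton g)]
        simp

end Concentration

/-! ### Cuts as sets of pairs. -/

section Cuts

variable {n : ℕ}

/-- The pairs with one end in `A` and the other outside `D`. -/
def cutPairs (A D : Finset (Fin n)) : Finset (Pair n) :=
  Finset.univ.filter fun e => (e.1.1 ∈ A ∧ e.1.2 ∉ D) ∨ (e.1.2 ∈ A ∧ e.1.1 ∉ D)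

lemma sum_cut_eq {A D : Finset (Fin n)} (hAD : A ⊆ D) (f : Pair n → ℝ) :
    ∑ a ∈ A, ∑ b ∈ Dᶜ, symWeight f a b = ∑ e ∈ cutPairs A D, f e := by
  set F : Fin n → Fin n → ℝ := fun a b => if a ∈ A ∧ b ∉ D then 1 else 0 with hF
  have h1 : ∑ a ∈ A, ∑ b ∈ Dᶜ, symWeight f a b = ∑ a, ∑ b, symWeight f a b * F a b := by
    rw [← Finset.sum_subset (Finset.subset_univ A)]
    · refine Finset.sum_congr rfl fun a ha => ?_
      rw [← Finset.sum_subset (Finset.subset_univ Dᶜ)]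
      · refine Finset.sum_congr rfl fun b hb => ?_
        simp only [hF]
        rw [if_pos ⟨ha, Finset.mem_compl.mp hb⟩, mul_one]
      · intro b _ hb
        simp only [hF]
        rw [if_neg fun h => hb (Finset.mem_compl.mpr h.2), mul_zero]
    · intro a _ ha
      refine Finset.sum_eq_zero fun b _ => ?_
      simp only [hF]
      rw [if_neg fun h => ha h.1, mul_zero]
  have h2 : ∑ a, ∑ b, symWeight f a b * F a b =
      ∑ e : Pair n, f e * (F e.1.1 e.1.2 + F e.1.2 e.1.1) := by
    simp only [symWeight, add_mul, Finset.sum_add_distrib, mul_add]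
    rw [sum_lowerWeight_mul, Finset.sum_comm, sum_lowerWeight_mul f fun i j => F j i]
  rw [h1, h2, cutPairs, Finset.sum_filter]
  refine Finset.sum_congr rfl fun e _ => ?_
  simp only [hF]
  by_cases h1 : e.1.1 ∈ A ∧ e.1.2 ∉ D
  · have h2 : ¬ (e.1.2 ∈ A ∧ e.1.1 ∉ D) := fun h => h.2 (hAD h1.1)
    simp [h1, h2]
  · by_cases h2 : e.1.2 ∈ A ∧ e.1.1 ∉ D
    · simp [h1, h2]
    · simp [h1, h2]

lemma symWeight_one {i j : Fin n} (h : i ≠ j) : symWeight (fun _ : Pair n => (1 : ℝ)) i j = 1 := by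
  unfold symWeight lowerWeight
  rcases lt_or_gt_of_ne h with h | h
  · simp [h, h.le]
  · simp [h, h.le]

lemma card_cutPairs {A D : Finset (Fin n)} (hAD : A ⊆ D) :
    ((cutPairs A D).card : ℝ) = A.card * (n - D.card) := by
  have h := sum_cut_eq hAD fun _ : Pair n => (1 : ℝ)
  have h1 : ∑ a ∈ A, ∑ b ∈ Dᶜ, symWeight (fun _ : Pair n => (1 : ℝ)) a b = ∑ a ∈ A, ∑ b ∈ Dᶜ, 1 := by
    refine Finset.sum_congr rfl fun a ha => Finset.sum_congr rfl fun b hb => symWeight_one ?_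
    rintro rfl
    exact (Finset.mem_compl.mp hb) (hAD ha)
  rw [h1] at h
  simp only [Finset.sum_const, nsmul_eq_mul, mul_one, Finset.card_compl, Fintype.card_fin] at h
  rw [Nat.cast_sub (by simpa using Finset.card_le_univ D)] at h
  exact h.symm

lemma sum_symWeight_row (f : Pair n → ℝ) (i : Fin n) :
    ∑ j, symWeight f i j = ∑ e ∈ cutPairs {i} {i}, f e := by
  rw [← sum_cut_eq (Finset.Subset.refl _), Finset.sum_singleton,
    ← Finset.sum_add_sum_compl {i} fun j => symWeight f i j]
  simp [symWeight, lowerWeight]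

end Cuts

lemma exp_neg_nat_mul_log {n : ℕ} (hn : 0 < n) (m : ℕ) :
    Real.exp (-(m * Real.log n)) = ((n : ℝ) ^ m)⁻¹ := by
  rw [Real.exp_neg, Real.exp_nat_mul, Real.exp_log (by positivity)]

/-! ### Expansion and degrees of the random comparison graph. -/

section RandomGraph

variable {Ω : Type*} [MeasurableSpace Ω] {μ : Measure Ω} [IsProbabilityMeasure μ] {n : ℕ}
  {b : Pair n → Ω → Bool}

/-- The sum over all subsets is `(1 + n⁻²)ⁿ ≤ e`. It makes the union bound over pairs of sets
factorize. -/
lemma sum_inv_sq_pow_card_le (hn : 2 ≤ n) :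
    ∑ A : Finset (Fin n), (((n : ℝ) ^ 2)⁻¹) ^ A.card ≤ 3 := by
  have h := Fintype.sum_pow_mul_eq_add_pow (Fin n) (((n : ℝ) ^ 2)⁻¹) 1
  simp only [one_pow, mul_one, Fintype.card_fin] at h
  rw [h]
  have hn' : (2 : ℝ) ≤ n := by exact_mod_cast hn
  calc (((n : ℝ) ^ 2)⁻¹ + 1) ^ n ≤ Real.exp (((n : ℝ) ^ 2)⁻¹) ^ n := by
        have := Real.add_one_le_exp (((n : ℝ) ^ 2)⁻¹)
        gcongr
    _ = Real.exp ((n : ℝ)⁻¹) := by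
        rw [← Real.exp_nat_mul]; congr 1; field_simp
    _ ≤ Real.exp 1 := Real.exp_le_exp.mpr (inv_le_one_of_one_le₀ (by linarith))
    _ ≤ 3 := by linarith [Real.exp_one_lt_d9]

lemma measureReal_cut_lt_le (hn : 2 ≤ n) (hb : ∀ e, Measurable (b e)) (hind : iIndepFun b μ)
    {q : ℝ} (hq0 : 0 ≤ q) (hq : ∀ e, q ≤ μ.real {ω | b e ω = true})
    (hnq : 480 * Real.log n ≤ n * q) {A D : Finset (Fin n)} (hAD : A ⊆ D)
    (hD : 2 * D.card ≤ n) (hDA : D.card ≤ 8 * A.card) :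
    μ.real {ω | ∑ a ∈ A, ∑ c ∈ Dᶜ, symWeight (fun e => indR (b e ω)) a c < n * q / 4 * A.card} ≤
      ((n : ℝ) ^ 12)⁻¹ * ((((n : ℝ) ^ 2)⁻¹) ^ A.card * (((n : ℝ) ^ 2)⁻¹) ^ D.card) := by
  rcases A.eq_empty_or_nonempty with rfl | hA
  · simp only [Finset.sum_empty, Finset.card_empty, Nat.cast_zero, mul_zero, lt_self_iff_false]
    simp only [Set.ofPred_false, measureReal_empty]
    positivity
  have hA1 : 1 ≤ A.card := hA.card_pos
  have hcard := card_cutPairs hAD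
  have hD' : (2 : ℝ) * D.card ≤ n := by exact_mod_cast hD
  have hcut : (A.card : ℝ) * (n / 2) ≤ (cutPairs A D).card := by
    rw [hcard]
    exact mul_le_mul_of_nonneg_left (by linarith) (by positivity)
  have h1 := chernoff_lower (μ := μ) hb hind (cutPairs A D) hq0 fun e _ => hq e
  have hsub : {ω | ∑ a ∈ A, ∑ c ∈ Dᶜ, symWeight (fun e => indR (b e ω)) a c <
      n * q / 4 * A.card} ⊆
      {ω | ∑ e ∈ cutPairs A D, indR (b e ω) ≤ q * (cutPairs A D).card / 2} := by
    intro ω hω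
    simp only [Set.mem_ofPred_eq] at hω ⊢
    rw [sum_cut_eq hAD] at hω
    nlinarith [mul_le_mul_of_nonneg_left hcut hq0]
  refine (measureReal_mono hsub).trans (h1.trans ?_)
  -- The cut has at least `|A| n/2` pairs, so the exponent is at least `nq|A|/16 ≥ 30 |A| log n`,
  -- whence `480 = 16 · 30`. As `|D| ≤ 8|A|` and `|A| ≥ 1`, `30|A| ≥ 12 + 2|A| + 2|D|`.
  have hexp : Real.exp (-(q * (cutPairs A D).card / 8)) ≤
      Real.exp (-((30 * A.card : ℕ) * Real.log n)) := by
    refine Real.exp_le_exp.mpr (neg_le_neg ?_)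
    push_cast
    have e1 := mul_le_mul_of_nonneg_left hcut hq0
    have e2 := mul_le_mul_of_nonneg_left hnq (by positivity : (0 : ℝ) ≤ A.card)
    nlinarith
  rw [exp_neg_nat_mul_log (by omega)] at hexp
  refine hexp.trans ?_
  rw [inv_pow, inv_pow, ← mul_inv, ← mul_inv, ← pow_mul, ← pow_mul, ← pow_add, ← pow_add]
  have hn1 : (1 : ℝ) ≤ n := by exact_mod_cast (by omega : 1 ≤ n)
  exact inv_anti₀ (by positivity) (pow_le_pow_right₀ hn1 (by omega))

lemma measureReal_not_expansion_le (hn : 2 ≤ n) (hb : ∀ e, Measurable (b e))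
    (hind : iIndepFun b μ) {q : ℝ} (hq0 : 0 ≤ q) (hq : ∀ e, q ≤ μ.real {ω | b e ω = true})
    (hnq : 480 * Real.log n ≤ n * q) :
    μ.real {ω | ¬ ∀ A D : Finset (Fin n), A ⊆ D → 2 * D.card ≤ Fintype.card (Fin n) →
      D.card ≤ 8 * A.card →
      n * q / 4 * A.card ≤ ∑ a ∈ A, ∑ c ∈ Dᶜ, symWeight (fun e => indR (b e ω)) a c} ≤
      9 * ((n : ℝ) ^ 10)⁻¹ := by
  classical
  set bad : Finset (Fin n) × Finset (Fin n) → Set Ω := fun s =>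
    if s.1 ⊆ s.2 ∧ 2 * s.2.card ≤ n ∧ s.2.card ≤ 8 * s.1.card then
      {ω | ∑ a ∈ s.1, ∑ c ∈ s.2ᶜ, symWeight (fun e => indR (b e ω)) a c < n * q / 4 * s.1.card}
    else ∅ with hbad
  have hsub : {ω | ¬ ∀ A D : Finset (Fin n), A ⊆ D → 2 * D.card ≤ Fintype.card (Fin n) →
      D.card ≤ 8 * A.card →
      n * q / 4 * A.card ≤ ∑ a ∈ A, ∑ c ∈ Dᶜ, symWeight (fun e => indR (b e ω)) a c} ⊆
      ⋃ s, bad s := by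
    intro ω hω
    simp only [Set.mem_ofPred_eq, Fintype.card_fin] at hω
    push Not at hω
    obtain ⟨A, D, h1, h2, h3, h4⟩ := hω
    refine Set.mem_iUnion.mpr ⟨(A, D), ?_⟩
    simp only [hbad]
    rw [if_pos ⟨h1, h2, h3⟩]
    exact h4
  refine (measureReal_mono hsub).trans ((measureReal_iUnion_fintype_le _).trans ?_)
  have hn1 : (1 : ℝ) ≤ n := by exact_mod_cast (by omega : 1 ≤ n)
  calc ∑ s, μ.real (bad s) ≤ ∑ s : Finset (Fin n) × Finset (Fin n), ((n : ℝ) ^ 12)⁻¹ *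
        ((((n : ℝ) ^ 2)⁻¹) ^ s.1.card * (((n : ℝ) ^ 2)⁻¹) ^ s.2.card) := by
        refine Finset.sum_le_sum fun s _ => ?_
        simp only [hbad]
        split_ifs with h
        · exact measureReal_cut_lt_le hn hb hind hq0 hq hnq h.1 h.2.1 h.2.2
        · rw [measureReal_empty]; positivity
    _ = ((n : ℝ) ^ 12)⁻¹ * ((∑ A : Finset (Fin n), (((n : ℝ) ^ 2)⁻¹) ^ A.card) *
        ∑ A : Finset (Fin n), (((n : ℝ) ^ 2)⁻¹) ^ A.card) := by
        rw [← Finset.mul_sum, Fintype.sum_prod_type, Finset.sum_mul_sum]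
    _ ≤ ((n : ℝ) ^ 10)⁻¹ * (3 * 3) := by
        have h3 := sum_inv_sq_pow_card_le hn
        have h0 : 0 ≤ ∑ A : Finset (Fin n), (((n : ℝ) ^ 2)⁻¹) ^ A.card :=
          Finset.sum_nonneg fun A _ => by positivity
        have h12 : ((n : ℝ) ^ 12)⁻¹ ≤ ((n : ℝ) ^ 10)⁻¹ :=
          inv_anti₀ (by positivity) (pow_le_pow_right₀ hn1 (by norm_num))
        gcongr
    _ = _ := by ring

/-- Each off-diagonal entry is at most `q` plus `p (φ i)` when the labels agree. The zero diagonal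
entry is over-counted harmlessly. -/
lemma sum_edgeProb_row_le {k : ℕ} (φ : Fin n → Fin k) {p : Fin k → ℝ} {q : ℝ} (hq0 : 0 ≤ q)
    (hp : ∀ t, 0 ≤ p t) (i : Fin n) :
    ∑ j, symWeight (edgeProb φ p q) i j ≤ clusterSize φ (φ i) * p (φ i) + n * q := by
  have h : ∀ j, symWeight (edgeProb φ p q) i j ≤ (if φ j = φ i then p (φ i) else 0) + q := by
    intro j
    have hpi := hp (φ i)
    rcases lt_trichotomy i j with h | h | h
    · by_cases hφ : φ j = φ i <;>
        simp [symWeight, lowerWeight, edgeProb, h, h.not_gt, hφ, hq0]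
    · simp only [symWeight, lowerWeight, h, lt_self_iff_false, dite_false, if_true]
      have := hp (φ j)
      linarith
    · by_cases hφ : φ i = φ j
      · simp [symWeight, lowerWeight, edgeProb, h, h.not_gt, hφ, hq0]
      · simp [symWeight, lowerWeight, edgeProb, h, h.not_gt, hφ, Ne.symm hφ]
  refine (Finset.sum_le_sum fun j _ => h j).trans (le_of_eq ?_)
  rw [Finset.sum_add_distrib, ← Finset.sum_filter, clusterSize]
  simp

lemma measureReal_not_degree_le (hn : 2 ≤ n) (hb : ∀ e, Measurable (b e)) (hind : iIndepFun b μ)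
    {k : ℕ} (φ : Fin n → Fin k) {p : Fin k → ℝ} {q : ℝ} (hq0 : 0 ≤ q) (hp : ∀ t, 0 ≤ p t)
    (hprob : ∀ e, μ.real {ω | b e ω = true} = edgeProb φ p q e)
    (hnq : 480 * Real.log n ≤ n * q) :
    μ.real {ω | ¬ ∀ i, ∑ j, symWeight (fun e => indR (b e ω)) i j ≤
      4 * (clusterSize φ (φ i) * p (φ i) + n * q)} ≤ ((n : ℝ) ^ 10)⁻¹ := by
  have hsub : {ω | ¬ ∀ i, ∑ j, symWeight (fun e => indR (b e ω)) i j ≤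
      4 * (clusterSize φ (φ i) * p (φ i) + n * q)} ⊆
      ⋃ i, {ω | 4 * (clusterSize φ (φ i) * p (φ i) + n * q) ≤
        ∑ e ∈ cutPairs {i} {i}, indR (b e ω)} := by
    intro ω hω
    simp only [Set.mem_ofPred_eq] at hω
    push Not at hω
    obtain ⟨i, hi⟩ := hω
    refine Set.mem_iUnion.mpr ⟨i, ?_⟩
    rw [sum_symWeight_row] at hi
    exact hi.le
  refine (measureReal_mono hsub).trans ((measureReal_iUnion_fintype_le _).trans ?_)
  have hn0 : (0 : ℝ) < n := by exact_mod_cast (by omega : 0 < n)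
  have hlog : 0 ≤ Real.log n := Real.log_natCast_nonneg n
  calc _ ≤ ∑ _i : Fin n, ((n : ℝ) ^ 11)⁻¹ := by
        refine Finset.sum_le_sum fun i _ => ?_
        have hM : ∑ e ∈ cutPairs {i} {i}, μ.real {ω | b e ω = true} ≤
            clusterSize φ (φ i) * p (φ i) + n * q := by
          simp only [hprob]
          rw [← sum_symWeight_row]
          exact sum_edgeProb_row_le φ hq0 hp i
        refine (chernoff_upper hb hind _ hM).trans ?_
        rw [← exp_neg_nat_mul_log (by omega)]
        refine Real.exp_le_exp.mpr (neg_le_neg ?_)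
        have : 0 ≤ clusterSize φ (φ i) * p (φ i) := mul_nonneg (by positivity) (hp _)
        push_cast
        linarith
    _ = _ := by
        rw [Finset.sum_const, Finset.card_univ, Fintype.card_fin, nsmul_eq_mul]
        field_simp

end RandomGraph

/-! ### The condition number as a bound on the curvature. -/

section Kappa

variable {n : ℕ} {θ : Fin n → ℝ}

lemma one_le_kappa (hn : 0 < n) (hθ : Antitone θ) : 1 ≤ kappa hn θ := by
  rw [kappa, ← Real.exp_sub]
  exact Real.one_le_exp (sub_nonneg.mpr (hθ (Fin.le_def.mpr (Nat.zero_le _))))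

lemma inv_four_mul_kappa_le_dsigmoid (hn : 0 < n) (hθ : Antitone θ) (e : Pair n) :
    1 / (4 * kappa hn θ) ≤ dsigmoid (pairDiff θ e) := by
  rw [kappa, ← Real.exp_sub]
  refine inv_four_mul_exp_le_dsigmoid ?_
  have hmax : ∀ i, θ i ≤ θ ⟨0, hn⟩ := fun i => hθ (Fin.le_def.mpr (Nat.zero_le _))
  have hmin : ∀ i, θ ⟨n - 1, Nat.sub_lt hn Nat.one_pos⟩ ≤ θ i := fun i =>
    hθ (Fin.le_def.mpr (by have := i.2; dsimp only; omega))
  rw [pairDiff, abs_le]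
  constructor
  · linarith [hmax e.1.1, hmin e.1.2]
  · linarith [hmax e.1.2, hmin e.1.1]

/-- Exchanges unweighted and curvature-weighted energy at the price `4κ`. It serves both for the
spectral gap and for the noise variance. -/
lemma pairEnergy_le (hn : 0 < n) (hθ : Antitone θ) {w : Pair n → ℝ} (hw : ∀ e, 0 ≤ w e)
    (u : Fin n → ℝ) :
    ∑ e, w e * pairDiff u e ^ 2 ≤
      4 * kappa hn θ * ∑ i, u i * lap (symWeight (curvature w θ)) u i := by
  have hκ : 0 < kappa hn θ := lt_of_lt_of_le one_pos (one_le_kappa hn hθ)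
  rw [sum_mul_lap_symWeight, Finset.mul_sum]
  refine Finset.sum_le_sum fun e _ => ?_
  have h := inv_four_mul_kappa_le_dsigmoid hn hθ e
  rw [div_le_iff₀ (by positivity)] at h
  have := mul_le_mul_of_nonneg_left h (mul_nonneg (hw e) (sq_nonneg (pairDiff u e)))
  rw [curvature]
  nlinarith

end Kappa

/-! ### Noise of the score against the potentials. -/

section Noise

variable {Ω : Type*} [MeasurableSpace Ω] {μ : Measure Ω} [IsProbabilityMeasure μ] {n L : ℕ}
  {θ : Fin n → ℝ} {outcome : Pair n → Fin L → Ω → Bool}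

/-- At the true `θ` the score is a weighted sum of centered independent outcomes, and averaging over
`L` repetitions divides the squared coefficients' sum by `L`. -/
lemma measureReal_noise_ge_le (hL : 0 < L) (hmeas : ∀ e l, Measurable (outcome e l))
    (hind : iIndepFun (fun s : Pair n × Fin L => outcome s.1 s.2) μ)
    (hprob : ∀ e l, μ.real {ω | outcome e l ω = true} = winProb θ e.1.2 e.1.1)
    (w : Pair n → ℝ) (u : Fin n → ℝ) {v s : ℝ} (hs : 0 ≤ s)
    (hv : ∑ e, (w e * pairDiff u e) ^ 2 ≤ v) :
    μ.real {ω | s ≤ |∑ e, pairScore w (fun e l => outcome e l ω) θ e * pairDiff u e|} ≤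
      2 * Real.exp (-(2 * s ^ 2 / (v / L))) := by
  have hL' : (0 : ℝ) < L := by positivity
  have hc : ∑ t : Pair n × Fin L, (-(1 / L * (w t.1 * pairDiff u t.1))) ^ 2 ≤ v / L := by
    rw [Fintype.sum_prod_type]
    simp only [Finset.sum_const, Finset.card_univ, Fintype.card_fin, nsmul_eq_mul]
    calc ∑ e, (L : ℝ) * (-(1 / L * (w e * pairDiff u e))) ^ 2 =
          (∑ e, (w e * pairDiff u e) ^ 2) / L := by
          rw [Finset.sum_div]
          exact Finset.sum_congr rfl fun e _ => by field_simp
      _ ≤ _ := div_le_div_of_nonneg_right hv hL'.le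
  have h := hoeffding_abs_indR (fun t : Pair n × Fin L => hmeas t.1 t.2) hind
    (fun t => -(1 / L * (w t.1 * pairDiff u t.1))) hc hs
  have heq : ∀ ω, ∑ e, pairScore w (fun e l => outcome e l ω) θ e * pairDiff u e =
      ∑ t : Pair n × Fin L, -(1 / L * (w t.1 * pairDiff u t.1)) *
        (indR (outcome t.1 t.2 ω) - μ.real {ω | outcome t.1 t.2 ω = true}) := by
    intro ω
    rw [Fintype.sum_prod_type]
    refine Finset.sum_congr rfl fun e _ => ?_
    rw [pairScore_mul]
    refine Finset.sum_congr rfl fun l _ => ?_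
    simp only [hprob, winProb_eq_sigmoid]
    rw [indR, pairDiff, pairDiff]
    ring
  simp only [heq]
  exact h

/-- For a fixed graph with good expansion and degrees, the potentials have small noise with high
probability. -/
lemma measureReal_not_potentials_le (hn : 2 ≤ n) (hL : 0 < L)
    (hmeas : ∀ e l, Measurable (outcome e l))
    (hind : iIndepFun (fun s : Pair n × Fin L => outcome s.1 s.2) μ)
    (hprob : ∀ e l, μ.real {ω | outcome e l ω = true} = winProb θ e.1.2 e.1.1)
    (w : Pair n → ℝ) (hw : ∀ e, 0 ≤ w e) (hw1 : ∀ e, w e ≤ 1) (hn0 : 0 < n) (hθ : Antitone θ)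
    {D Λ ε : ℝ} (hD0 : 0 < D) (hΛ : 0 < Λ) (hε : 0 ≤ ε)
    (hD : ∀ i, ∑ j, symWeight w i j ≤ D)
    (hgap : ∀ x : Fin n → ℝ, ∑ i, x i = 0 →
      Λ * ∑ i, x i ^ 2 ≤ ∑ i, x i * lap (symWeight (curvature w θ)) x i)
    (hεn : 11 * Real.log n ≤ 2 * (ε / 8) ^ 2 / (8 * kappa hn0 θ / Λ / L)) :
    μ.real {ω | ¬ ∀ i, ∃ u r : Fin n → ℝ,
      (∀ j, lap (symWeight (curvature w θ)) u j = (if j = i then 1 else 0) - 1 / n - r j) ∧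
      ∑ j, |r j| ≤ 1 / 2 ∧
      ∑ a, ∑ b, symWeight (curvature w θ) a b * |u a - u b| ≤
        14 * Real.log n * √(D / Λ) ∧
      |∑ e, pairScore w (fun e l => outcome e l ω) θ e * pairDiff u e| ≤ ε / 8} ≤
      2 * ((n : ℝ) ^ 10)⁻¹ := by
  have hκ : 0 < kappa hn0 θ := lt_of_lt_of_le one_pos (one_le_kappa hn0 hθ)
  have hcurv0 : ∀ e, 0 ≤ curvature w θ e := fun e => mul_nonneg (hw e) (dsigmoid_pos _).le
  have hcurv : ∀ e, curvature w θ e ≤ w e := fun e =>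
    mul_le_of_le_one_right (hw e) (dsigmoid_le_one _)
  have hpot := fun i => exists_potential (symWeight_comm (curvature w θ))
    (symWeight_nonneg hcurv0) hD0 hΛ
    (fun i => (Finset.sum_le_sum fun j _ => symWeight_mono hcurv i j).trans (hD i)) hgap
    (by simpa using hn) i
  simp only [Fintype.card_fin] at hpot
  choose u r hlap hr hE hTV using hpot
  have hsub : {ω | ¬ ∀ i, ∃ u r : Fin n → ℝ,
      (∀ j, lap (symWeight (curvature w θ)) u j = (if j = i then 1 else 0) - 1 / n - r j) ∧
      ∑ j, |r j| ≤ 1 / 2 ∧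
      ∑ a, ∑ b, symWeight (curvature w θ) a b * |u a - u b| ≤
        14 * Real.log n * √(D / Λ) ∧
      |∑ e, pairScore w (fun e l => outcome e l ω) θ e * pairDiff u e| ≤ ε / 8} ⊆
      ⋃ i, {ω | ε / 8 ≤
        |∑ e, pairScore w (fun e l => outcome e l ω) θ e * pairDiff (u i) e|} := by
    intro ω hω
    rw [Set.mem_ofPred_eq, not_forall] at hω
    obtain ⟨i, hi⟩ := hω
    refine Set.mem_iUnion.mpr ⟨i, ?_⟩
    by_contra hlt
    exact hi ⟨u i, r i, hlap i, hr i, hTV i, (not_le.mp hlt).le⟩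
  refine (measureReal_mono hsub).trans ((measureReal_iUnion_fintype_le _).trans ?_)
  calc _ ≤ ∑ _i : Fin n, 2 * ((n : ℝ) ^ 11)⁻¹ := by
        refine Finset.sum_le_sum fun i _ => ?_
        -- Since `0 ≤ w ≤ 1`, `w² ≤ w`, so the variance proxy is at most the unweighted energy,
        -- hence at most `4κ` times `2/Λ`.
        have hv : ∑ e, (w e * pairDiff (u i) e) ^ 2 ≤ 8 * kappa hn0 θ / Λ := by
          calc ∑ e, (w e * pairDiff (u i) e) ^ 2 ≤ ∑ e, w e * pairDiff (u i) e ^ 2 := by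
                refine Finset.sum_le_sum fun e _ => ?_
                rw [mul_pow]
                refine mul_le_mul_of_nonneg_right ?_ (sq_nonneg _)
                nlinarith [hw e, hw1 e]
            _ ≤ 4 * kappa hn0 θ * (2 / Λ) := (pairEnergy_le hn0 hθ hw (u i)).trans
                (mul_le_mul_of_nonneg_left (hE i) (by positivity))
            _ = _ := by ring
        refine (measureReal_noise_ge_le hL hmeas hind hprob w (u i) (by positivity) hv).trans ?_
        rw [← exp_neg_nat_mul_log hn0]
        refine mul_le_mul_of_nonneg_left (Real.exp_le_exp.mpr (neg_le_neg ?_)) zero_le_two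
        push_cast
        exact hεn
    _ = _ := by
        rw [Finset.sum_const, Finset.card_univ, Fintype.card_fin, nsmul_eq_mul]
        field_simp

end Noise

/-! ### Choice of constants and the union of failure events. -/

section Assembly

lemma indepFun_edge_outcome {Ω : Type*} [MeasurableSpace Ω] {μ : Measure Ω}
    {n k L : ℕ} {φ : Fin n → Fin k} {p : Fin k → ℝ} {q : ℝ} {θ : Fin n → ℝ}
    {edge : Pair n → Ω → Bool} {outcome : Pair n → Fin L → Ω → Bool}
    (h : IsClusteredBTL μ φ p q θ edge outcome) :
    IndepFun (fun ω e => edge e ω) (fun ω (s : Pair n × Fin L) => outcome s.1 s.2 ω) μ := by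
  classical
  set S : Finset (Pair n ⊕ (Pair n × Fin L)) := Finset.univ.map Function.Embedding.inl with hS
  set T : Finset (Pair n ⊕ (Pair n × Fin L)) := Finset.univ.map Function.Embedding.inr with hT
  have hST : Disjoint S T := by
    rw [Finset.disjoint_left]
    rintro (e | e) h1 h2 <;> simp [hS, hT] at h1 h2
  have hmeas : ∀ i, Measurable ((Sum.elim edge (fun s : Pair n × Fin L => outcome s.1 s.2) :
      Pair n ⊕ (Pair n × Fin L) → Ω → Bool) i) := by
    rintro (e | s)
    · exact h.measurable_edge e
    · exact h.measurable_outcome s.1 s.2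
  have hind := h.indep.indepFun_finset S T hST hmeas
  exact hind.comp (φ := fun (f : S → Bool) (e : Pair n) => f ⟨Sum.inl e, by simp [hS]⟩)
    (ψ := fun (f : T → Bool) (s : Pair n × Fin L) => f ⟨Sum.inr s, by simp [hT]⟩)
    (by fun_prop) (by fun_prop)

/-- The arithmetic behind the choice of constants. -/
lemma constants_arith {Q κ l L d ε Λ : ℝ} (hQ : 0 < Q) (hκ : 1 ≤ κ) (hl : 1 / 2 ≤ l) (hL : 0 < L)
    (hQL : 41287680 ^ 2 * κ ^ 4 * l ^ 3 ≤ Q * L)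
    (hd : d = 8 * (Q ^ 2 * L) / (41287680 ^ 2 * κ ^ 4 * l ^ 3))
    (hε : ε = 640 * κ * √(l / (Q * L))) (hΛ : Λ = Q / (128 * κ)) :
    ε ≤ 1 / 2 ∧ 144 * ε * (14 * l * √(d / Λ)) ≤ 1 ∧
      11 * l ≤ 2 * (ε / 8) ^ 2 / (8 * κ / Λ / L) := by
  have hκ0 : 0 < κ := by linarith
  have hl0 : 0 < l := by linarith
  have hε2 : ε ^ 2 = 640 ^ 2 * κ ^ 2 * (l / (Q * L)) := by
    rw [hε, mul_pow, mul_pow, Real.sq_sqrt (by positivity)]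
  have hd0 : 0 < d := by rw [hd]; positivity
  have hΛ0 : 0 < Λ := by rw [hΛ]; positivity
  refine ⟨?_, ?_, ?_⟩
  · refine le_of_sq_le_sq ?_ (by norm_num)
    rw [hε2, ← mul_div_assoc, div_le_iff₀ (by positivity)]
    have h1 : κ ^ 2 ≤ κ ^ 4 := pow_le_pow_right₀ hκ (by norm_num)
    have h2 : l ≤ 4 * l ^ 3 := by nlinarith [sq_nonneg (l - 1 / 2)]
    have h3 : κ ^ 2 * l ≤ κ ^ 4 * (4 * l ^ 3) := by gcongr
    nlinarith [mul_pos (pow_pos hκ0 4) (pow_pos hl0 3)]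
  · refine le_of_sq_le_sq ?_ (by norm_num)
    have hdΛ : d / Λ = 1024 * (Q * L) / (41287680 ^ 2 * κ ^ 3 * l ^ 3) := by
      rw [hd, hΛ]; field_simp; norm_num
    -- `41287680 = 144 · 640 · 14 · 32`, where `32² = 1024` comes from `d / Λ`, is chosen so that
    -- every numerical factor cancels.
    have : (144 * ε * (14 * l * √(d / Λ))) ^ 2 = 1 / κ := by
      rw [mul_pow, mul_pow, mul_pow (14 * l), Real.sq_sqrt (by positivity), hε2, hdΛ]
      field_simp; norm_num
    rw [this, one_pow]
    rw [div_le_one hκ0]; exact hκ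
  -- The factor `640` in `ε` gives `12.5 ≥ 11`: exponent `11` for each item leaves `n⁻¹⁰` after the
  -- union over items.
  · have : 2 * (ε / 8) ^ 2 / (8 * κ / Λ / L) = 12.5 * l := by
      rw [div_pow, hε2, hΛ]; field_simp; norm_num
    rw [this]; linarith

end Assembly

/-- On a graph with good expansion and degrees, potentials with small noise give an accurate and
unique estimate, which recovers the top items. -/
lemma mle_recovery_of_potentials {n L : ℕ} (hn : 0 < n) (hL : 0 < L) {q : ℝ} {θ : Fin n → ℝ}
    {g : Pair n → Bool} {y : Pair n → Fin L → Bool} {ε B Λ : ℝ} (hanti : Antitone θ)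
    (hsum : ∑ i, θ i = 0) (hQ : 0 < n * q) (hlog : 0 < Real.log n)
    (hε : ε = 640 * kappa hn θ * √(Real.log n / (n * q * L))) (hε2 : ε ≤ 1 / 2)
    (hB : 144 * ε * B ≤ 1) (hΛ : 0 < Λ)
    (hgap : ∀ x : Fin n → ℝ, ∑ i, x i = 0 → Λ * ∑ i, x i ^ 2 ≤
      ∑ i, x i * lap (symWeight (curvature (fun e => indR (g e)) θ)) x i)
    (hpot : ∀ i, ∃ u r : Fin n → ℝ,
      (∀ j, lap (symWeight (curvature (fun e => indR (g e)) θ)) u j =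
        (if j = i then 1 else 0) - 1 / n - r j) ∧
      ∑ j, |r j| ≤ 1 / 2 ∧
      ∑ a, ∑ b, symWeight (curvature (fun e => indR (g e)) θ) a b * |u a - u b| ≤ B ∧
      |∑ e, pairScore (fun e => indR (g e)) y θ e * pairDiff u e| ≤ ε / 8) :
    (∃! x : Fin n → ℝ, IsMLE g y x) ∧ ∀ x : Fin n → ℝ, IsMLE g y x →
      ‖x - θ‖ ≤ 640 * kappa hn θ * √(Real.log n / (n * q * L)) ∧
      ∀ (K : ℕ) (_ : 1 ≤ K) (hKn : K < n), 0 < scoreGap θ K hKn →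
        9 * 640 ^ 2 * (kappa hn θ ^ 2 * n * Real.log n / scoreGap θ K hKn ^ 2) ≤
          (n : ℝ) ^ 2 * q * L → RecoversTopK x K := by
  have : NeZero n := ⟨hn.ne'⟩
  have hκ : 0 < kappa hn θ := lt_of_lt_of_le one_pos (one_le_kappa hn hanti)
  have hL' : (0 : ℝ) < L := by positivity
  have hn' : (0 : ℝ) < n := by positivity
  have hε0 : 0 < ε := by rw [hε]; positivity
  obtain ⟨x, hx, hxε, huniq⟩ := exists_weightedMLE_near (fun e => indR_nonneg (g e)) hL y hsum
    hε0.le hε2 hB hΛ hgap hpot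
  refine ⟨⟨x, hx, huniq⟩, fun x' hx' => ?_⟩
  obtain rfl := huniq x' hx'
  refine ⟨hε ▸ hxε, fun K hK1 hKn hΔ hK => recoversTopK_of_norm_sub_le hK1 hKn hanti hxε ?_⟩
  set Δ := scoreGap θ K hKn
  -- `9 · 640²` is the square of `3 · 640`. Three times the error is asked for, so that twice the
  -- error is strictly below the gap.
  have h3 : 3 * ε ≤ Δ := by
    refine le_of_sq_le_sq ?_ hΔ.le
    rw [hε, mul_pow, mul_pow, mul_pow, Real.sq_sqrt (by positivity)]
    rw [← mul_div_assoc, div_le_iff₀ (by positivity)] at hK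
    rw [← mul_div_assoc, ← mul_div_assoc, div_le_iff₀ (by positivity)]
    refine le_of_mul_le_mul_right ?_ hn'
    calc _ = 9 * 640 ^ 2 * (kappa hn θ ^ 2 * n * Real.log n) := by ring
      _ ≤ _ := hK
      _ = _ := by ring
  linarith

/-- The main bound for `n ≥ 2`, with explicit constants. -/
theorem mle_recovery {Ω : Type*} [MeasurableSpace Ω] {μ : Measure Ω} [IsProbabilityMeasure μ]
    {n k L : ℕ} (hn2 : 2 ≤ n) (hn : 0 < n) (hL : 0 < L) {φ : Fin n → Fin k} {p : Fin k → ℝ}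
    {q : ℝ} {θ : Fin n → ℝ} {edge : Pair n → Ω → Bool} {outcome : Pair n → Fin L → Ω → Bool}
    (hq0 : 0 ≤ q) (hqp : ∀ t, q < p t) (hanti : Antitone θ) (hsum : ∑ i, θ i = 0)
    (hbtl : IsClusteredBTL μ φ p q θ edge outcome) (hnq : 480 * Real.log n ≤ n * q)
    (hC2 : 41287680 ^ 2 * kappa hn θ ^ 4 * Real.log n ^ 3 ≤ n * q * L)
    (hC2t : ∀ t, 41287680 ^ 2 * kappa hn θ ^ 4 * (clusterSize φ t * p t) * Real.log n ^ 3 ≤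
      (n : ℝ) ^ 2 * q ^ 2 * L) :
    1 - 12 * ((n : ℝ) ^ 10)⁻¹ ≤ μ.real {ω |
      (∃! x : Fin n → ℝ, IsMLE (fun e => edge e ω) (fun e l => outcome e l ω) x) ∧
      ∀ x : Fin n → ℝ, IsMLE (fun e => edge e ω) (fun e l => outcome e l ω) x →
        ‖x - θ‖ ≤ 640 * kappa hn θ * √(Real.log n / (n * q * L)) ∧
        ∀ (K : ℕ) (_ : 1 ≤ K) (hKn : K < n), 0 < scoreGap θ K hKn →
          9 * 640 ^ 2 * (kappa hn θ ^ 2 * n * Real.log n / scoreGap θ K hKn ^ 2) ≤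
            (n : ℝ) ^ 2 * q * L → RecoversTopK x K} := by
  have : NeZero n := ⟨hn.ne'⟩
  have hκ1 : 1 ≤ kappa hn θ := one_le_kappa hn hanti
  have hκ : 0 < kappa hn θ := by linarith
  have hn2' : (2 : ℝ) ≤ n := by exact_mod_cast hn2
  have hlog2 : 1 / 2 ≤ Real.log n :=
    le_trans (by linarith [Real.log_two_gt_d9]) (Real.log_le_log (by norm_num) hn2')
  have hlog : 0 < Real.log n := by linarith
  have hQ : 0 < n * q := by linarith
  have hL' : (0 : ℝ) < L := by positivity
  have hp : ∀ t, 0 ≤ p t := fun t => hq0.trans (hqp t).le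
  -- The largest degree bound that the sample-size hypotheses allow: `n_t p_t` and `nq` are each at
  -- most `d/8`, and the Chernoff bound costs a factor `4`.
  set d : ℝ := 8 * ((n * q) ^ 2 * L) / (41287680 ^ 2 * kappa hn θ ^ 4 * Real.log n ^ 3) with hd
  set ε : ℝ := 640 * kappa hn θ * √(Real.log n / (n * q * L)) with hε
  -- Expansion `nq/4` gives an unweighted gap `nq/32`, and the curvature weights divide it by `4κ`.
  set Λ : ℝ := n * q / (128 * kappa hn θ) with hΛ
  obtain ⟨hε2, hB, hnoise⟩ := constants_arith hQ hκ1 hlog2 hL' hC2 hd hε hΛ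
  have hε0 : 0 ≤ ε := by positivity
  have hd0 : 0 < d := by positivity
  have hΛ0 : 0 < Λ := by positivity
  have hindE : iIndepFun edge μ := hbtl.indep.precomp (g := Sum.inl) Sum.inl_injective
  have hindY : iIndepFun (fun s : Pair n × Fin L => outcome s.1 s.2) μ :=
    hbtl.indep.precomp (g := Sum.inr) Sum.inr_injective
  have hqe : ∀ e, q ≤ μ.real {ω | edge e ω = true} := by
    intro e
    rw [hbtl.prob_edge, edgeProb]
    split_ifs
    · exact (hqp _).le
    · exact le_rfl
  set G₁ : Set (Pair n → Bool) := {g | ∀ A D : Finset (Fin n), A ⊆ D →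
    2 * D.card ≤ Fintype.card (Fin n) → D.card ≤ 8 * A.card →
    n * q / 4 * A.card ≤ ∑ a ∈ A, ∑ c ∈ Dᶜ, symWeight (fun e => indR (g e)) a c} with hG₁
  set G₂ : Set (Pair n → Bool) := {g | ∀ i, ∑ j, symWeight (fun e => indR (g e)) i j ≤
    4 * (clusterSize φ (φ i) * p (φ i) + n * q)} with hG₂
  have hdeg : ∀ i, 4 * (clusterSize φ (φ i) * p (φ i) + n * q) ≤ d := by
    intro i
    have h1 := hC2t (φ i)
    have h2 := mul_le_mul_of_nonneg_left hC2 hQ.le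
    rw [hd, le_div_iff₀ (by positivity)]
    nlinarith
  have hgap : ∀ g ∈ G₁, ∀ x : Fin n → ℝ, ∑ i, x i = 0 → Λ * ∑ i, x i ^ 2 ≤
      ∑ i, x i * lap (symWeight (curvature (fun e => indR (g e)) θ)) x i := by
    intro g hg x hx
    have h1 := spectral_gap_of_expansion (symWeight_comm fun e => indR (g e))
      (symWeight_nonneg fun e => indR_nonneg (g e)) (by positivity) hg x hx
    rw [sum_mul_lap_symWeight] at h1
    have h2 := pairEnergy_le hn hanti (fun e => indR_nonneg (g e)) x
    simp only [sq] at h2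
    have h3 := h1.trans h2
    have h4 : n * q / 4 / 8 * ∑ i, x i ^ 2 = 4 * kappa hn θ * (Λ * ∑ i, x i ^ 2) := by
      rw [hΛ]; field_simp; ring
    rw [h4] at h3
    exact le_of_mul_le_mul_left h3 (by positivity)
  set bad : (Pair n → Bool) → Set (Pair n × Fin L → Bool) := fun g => {y | ¬ ∀ i,
    ∃ u r : Fin n → ℝ,
      (∀ j, lap (symWeight (curvature (fun e => indR (g e)) θ)) u j =
        (if j = i then 1 else 0) - 1 / n - r j) ∧
      ∑ j, |r j| ≤ 1 / 2 ∧
      ∑ a, ∑ b, symWeight (curvature (fun e => indR (g e)) θ) a b * |u a - u b| ≤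
        14 * Real.log n * √(d / Λ) ∧
      |∑ e, pairScore (fun e => indR (g e)) (fun e l => y (e, l)) θ e * pairDiff u e| ≤ ε / 8}
    with hbad
  -- For a fixed good graph the potentials are deterministic, so the noise bound applies.
  -- Independence of graph and outcomes then lets it be averaged over graphs.
  have hbad_le : μ.real {ω | (fun e => edge e ω) ∈ G₁ ∩ G₂ ∧
      (fun s : Pair n × Fin L => outcome s.1 s.2 ω) ∈ bad fun e => edge e ω} ≤
      2 * ((n : ℝ) ^ 10)⁻¹ := by
    refine measureReal_mem_and_le_of_indepFun (measurable_pi_lambda _ hbtl.measurable_edge)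
      (indepFun_edge_outcome hbtl) (G₁ ∩ G₂) bad (by positivity) fun g hg => ?_
    exact measureReal_not_potentials_le hn2 hL hbtl.measurable_outcome hindY hbtl.prob_outcome
      (fun e => indR (g e)) (fun e => indR_nonneg (g e)) (fun e => indR_le_one (g e)) hn hanti hd0
      hΛ0 hε0 (fun i => (hg.2 i).trans (hdeg i)) (hgap g hg.1) hnoise
  have hG₁_le : μ.real {ω | (fun e => edge e ω) ∉ G₁} ≤ 9 * ((n : ℝ) ^ 10)⁻¹ :=
    measureReal_not_expansion_le hn2 hbtl.measurable_edge hindE hq0 hqe hnq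
  have hG₂_le : μ.real {ω | (fun e => edge e ω) ∉ G₂} ≤ ((n : ℝ) ^ 10)⁻¹ :=
    measureReal_not_degree_le hn2 hbtl.measurable_edge hindE φ hq0 hp hbtl.prob_edge hnq
  set T := {ω |
      (∃! x : Fin n → ℝ, IsMLE (fun e => edge e ω) (fun e l => outcome e l ω) x) ∧
      ∀ x : Fin n → ℝ, IsMLE (fun e => edge e ω) (fun e l => outcome e l ω) x →
        ‖x - θ‖ ≤ ε ∧
        ∀ (K : ℕ) (_ : 1 ≤ K) (hKn : K < n), 0 < scoreGap θ K hKn →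
          9 * 640 ^ 2 * (kappa hn θ ^ 2 * n * Real.log n / scoreGap θ K hKn ^ 2) ≤
            (n : ℝ) ^ 2 * q * L → RecoversTopK x K} with hT
  -- Covering the whole space uses only monotonicity and subadditivity, so measurability of the
  -- success event is not needed. The failures add up to `9 + 1 + 2 = 12`.
  have hcover : (Set.univ : Set Ω) ⊆ T ∪ ({ω | (fun e => edge e ω) ∉ G₁} ∪
      ({ω | (fun e => edge e ω) ∉ G₂} ∪ {ω | (fun e => edge e ω) ∈ G₁ ∩ G₂ ∧
        (fun s : Pair n × Fin L => outcome s.1 s.2 ω) ∈ bad fun e => edge e ω})) := by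
    intro ω _
    by_cases h1 : (fun e => edge e ω) ∈ G₁
    swap
    · exact Or.inr (Or.inl h1)
    by_cases h2 : (fun e => edge e ω) ∈ G₂
    swap
    · exact Or.inr (Or.inr (Or.inl h2))
    by_cases h3 : (fun s : Pair n × Fin L => outcome s.1 s.2 ω) ∈ bad fun e => edge e ω
    · exact Or.inr (Or.inr (Or.inr ⟨⟨h1, h2⟩, h3⟩))
    refine Or.inl ?_
    have hpot := not_not.mp h3
    exact mle_recovery_of_potentials hn hL hanti hsum hQ hlog hε hε2 hB hΛ0 (hgap _ h1) hpot
  have h1 := measureReal_mono (μ := μ) hcover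
  rw [probReal_univ] at h1
  have h2 := measureReal_union_le (μ := μ) T ({ω | (fun e => edge e ω) ∉ G₁} ∪
      ({ω | (fun e => edge e ω) ∉ G₂} ∪ {ω | (fun e => edge e ω) ∈ G₁ ∩ G₂ ∧
        (fun s : Pair n × Fin L => outcome s.1 s.2 ω) ∈ bad fun e => edge e ω}))
  have h3 := measureReal_union_le (μ := μ) {ω | (fun e => edge e ω) ∉ G₁}
      ({ω | (fun e => edge e ω) ∉ G₂} ∪ {ω | (fun e => edge e ω) ∈ G₁ ∩ G₂ ∧
        (fun s : Pair n × Fin L => outcome s.1 s.2 ω) ∈ bad fun e => edge e ω})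
  have h4 := measureReal_union_le (μ := μ) {ω | (fun e => edge e ω) ∉ G₂}
      {ω | (fun e => edge e ω) ∈ G₁ ∩ G₂ ∧
        (fun s : Pair n × Fin L => outcome s.1 s.2 ω) ∈ bad fun e => edge e ω}
  linarith

end ClusterRanking

end

theorem mainTheorem8 :
    ∃ C₁ C₂ C₃ C₄ C₅ : ℝ, 0 < C₁ ∧ 0 < C₂ ∧ 0 < C₃ ∧ 0 < C₄ ∧ 0 < C₅ ∧
      ∀ (Ω : Type*) [MeasurableSpace Ω] (μ : Measure Ω) [IsProbabilityMeasure μ]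
        (n k L : ℕ) (hn : 0 < n) (_hL : 0 < L)
        (φ : Fin n → Fin k) (p : Fin k → ℝ) (q : ℝ) (θ : Fin n → ℝ)
        (edge : ClusterRanking.Pair n → Ω → Bool)
        (outcome : ClusterRanking.Pair n → Fin L → Ω → Bool),
        0 ≤ q → (∀ t, q < p t) → (∀ t, p t ≤ 1) →
        Antitone θ → ∑ i, θ i = 0 →
        ClusterRanking.IsClusteredBTL μ φ p q θ edge outcome →
        C₁ * Real.log n ≤ n * q →
        (∀ t, C₁ * Real.log n ≤ ClusterRanking.clusterSize φ t * p t) →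
        C₂ * ClusterRanking.kappa hn θ ^ 4 * Real.log n ^ 3 ≤ n * q * L →
        (∀ t, C₂ * ClusterRanking.kappa hn θ ^ 4 *
            (ClusterRanking.clusterSize φ t * p t) * Real.log n ^ 3 ≤
          (n : ℝ) ^ 2 * q ^ 2 * L) →
        1 - C₅ * ((n : ℝ) ^ 10)⁻¹ ≤ μ.real {ω |
          (∃! x : Fin n → ℝ,
            ClusterRanking.IsMLE (fun e => edge e ω) (fun e l => outcome e l ω) x) ∧
          ∀ x : Fin n → ℝ,
            ClusterRanking.IsMLE (fun e => edge e ω) (fun e l => outcome e l ω) x →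
            ‖x - θ‖ ≤ C₃ * ClusterRanking.kappa hn θ * √(Real.log n / (n * q * L)) ∧
            ∀ (K : ℕ) (_ : 1 ≤ K) (hKn : K < n),
              0 < ClusterRanking.scoreGap θ K hKn →
              C₄ * (ClusterRanking.kappa hn θ ^ 2 * n * Real.log n /
                  ClusterRanking.scoreGap θ K hKn ^ 2) ≤ (n : ℝ) ^ 2 * q * L →
              ClusterRanking.RecoversTopK x K} := by
  refine ⟨480, 41287680 ^ 2, 640, 9 * 640 ^ 2, 12, by norm_num, by norm_num, by norm_num,
    by norm_num, by norm_num, ?_⟩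
  intro Ω _ μ _ n k L hn hL φ p q θ edge outcome hq0 hqp _ hanti hsum hbtl hnq _ hC2 hC2t
  rcases Nat.lt_or_ge n 2 with hn1 | hn2
  -- For `n = 1` the claimed lower bound is `1 - 12 < 0`; this case is separate because `log n`
  -- vanishes.
  · obtain rfl : n = 1 := by omega
    refine le_trans ?_ measureReal_nonneg
    norm_num
  exact ClusterRanking.mle_recovery hn2 hn hL hq0 hqp hanti hsum hbtl hnq hC2 hC2t
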